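/- Write $(a)_k=a(a+1)\cdots(a+k-1)$ for the Pochhammer symbol and $${}_pF_q(a_1,\dots,a_p;b_1,\dots,b_q;z)=\sum_{k=0}^\infty\frac{(a_1)_k\cdots(a_p)_k}{(b_1)_k\cdots(b_q)_k}\frac{z^k}{k!}.$$ Let $F_3(\alpha,\alpha',\beta,\beta';\gamma;u,v)$ be the third Appell function, that is, the double series $$\sum_{m,n\ge 0}\frac{(\alpha)_m(\alpha')_n(\beta)_m(\beta')_n}{(\gamma)_{m+n}\,m!\,n!}u^mv^n\qquad(|u|,|v|<1)$$ and its holomorphic continuation from a neighbourhood of the origin to $\{|u|<1,\ \operatorname{Re}v<1/2\}$. For $x>0$ and $\operatorname{Re}\gamma>0$ put $$\bigl(I_{0,+}^{\alpha,\alpha',\beta,\beta',\gamma}f\bigr)(x)=\frac{x^{-\alpha}}{\Gamma(\gamma)}\int_0^x(x-t)^{\gamma-1}t^{-\alpha'}F_3\Bigl(\alpha,\alpha',\beta,\beta';\gamma;1-\frac tx,1-\frac xt\Bigr)f(t)\,dt.$$ **Corollary.** Let $\alpha,\alpha',\beta,\beta',\gamma,\rho,c\in\mathbb C$ and $x>0$.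 Suppose that $\operatorname{Re}\gamma>0$, that $$\operatorname{Re}\rho>\max\{0,\ \operatorname{Re}(\alpha+\alpha'+\beta-\gamma),\ \operatorname{Re}(\alpha'-\beta')\},$$ and that none of the lower parameters of the ${}_6F_7$ series below is zero or a negative integer (equivalently, none of $\rho+\beta'$, $\rho+\gamma-\alpha-\alpha'$, $\rho+\gamma-\alpha'-\beta$ is). Then the integrals defining the left-hand sides converge absolutely, the series on the right-hand sides converge absolutely, and $$\bigl(I_{0,+}^{\alpha,\alpha',\beta,\beta',\gamma}\,t^{\rho-1}\cos(ct)\bigr)(x)=R\,x^{\rho-\alpha-\alpha'+\gamma-1}\,\Phi\Bigl(-\frac{c^2x^2}{4}\Bigr),$$ $$\bigl(I_{0,+}^{\alpha,\alpha',\beta,\beta',\gamma}\,t^{\rho-1}\cosh(ct)\bigr)(x)=R\,x^{\rho-\alpha-\alpha'+\gamma-1}\,\Phi\Bigl(\frac{c^2x^2}{4}\Bigr),$$ where $$R=\frac{\Gamma(\rho)\,\Gamma(\rho+\gamma-\alpha-\alpha'-\beta)\,\Gamma(\rho+\beta'-\alpha')}{\Gamma(\rho+\beta')\,\Gamma(\rho+\gamma-\alpha-\alpha')\,\Gamma(\rho+\gamma-\alpha'-\beta)}$$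 and $$\Phi(z)={}_6F_7\left[\begin{array}{l}\frac{\rho}{2},\frac{\rho+1}{2},\frac{\rho+\gamma-\alpha-\alpha'-\beta}{2},\frac{\rho+\gamma-\alpha-\alpha'-\beta+1}{2},\frac{\rho+\beta'-\alpha'}{2},\frac{\rho+\beta'-\alpha'+1}{2};\\[2pt] \frac12,\frac{\rho+\beta'}{2},\frac{\rho+\beta'+1}{2},\frac{\rho+\gamma-\alpha-\alpha'}{2},\frac{\rho+\gamma-\alpha-\alpha'+1}{2},\frac{\rho+\gamma-\alpha'-\beta}{2},\frac{\rho+\gamma-\alpha'-\beta+1}{2}\end{array}\,\middle|\,z\right].$$ -/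

import Mathlib

open scoped Topology

noncomputable section

/-- The Pochhammer symbol `(a)_k = a (a + 1) ⋯ (a + k - 1)`. -/
def pochhammerC (a : ℂ) (k : ℕ) : ℂ := (ascPochhammer ℂ k).eval a

/-- The `k`-th term of the generalized hypergeometric series `ₚF_q(a; b; z)`. -/
def genHypergeometricTerm {p q : ℕ} (a : Fin p → ℂ) (b : Fin q → ℂ) (z : ℂ) (k : ℕ) : ℂ :=
  (∏ i, pochhammerC (a i) k) / ((∏ j, pochhammerC (b j) k) * pochhammerC 1 k) * z ^ k

/-- The generalized hypergeometric function `ₚF_q(a; b; z)`, as the sum of its series. -/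
def genHypergeometric {p q : ℕ} (a : Fin p → ℂ) (b : Fin q → ℂ) (z : ℂ) : ℂ :=
  ∑' k : ℕ, genHypergeometricTerm a b z k

/-- The double series of the third Appell function `F₃(a, a', b, b'; c; u, v)`; it converges
absolutely for `|u| < 1`, `|v| < 1`. -/
def appellF3Series (a a' b b' c u v : ℂ) : ℂ :=
  ∑' mn : ℕ × ℕ,
    pochhammerC a mn.1 * pochhammerC a' mn.2 * pochhammerC b mn.1 * pochhammerC b' mn.2 /
      (pochhammerC c (mn.1 + mn.2) * (mn.1.factorial : ℂ) * (mn.2.factorial : ℂ)) *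
      u ^ mn.1 * v ^ mn.2

/-- The convex open set `{|u| < 1, Re v < 1/2}`. It contains the origin and all the points
`(1 - t/x, 1 - x/t)` with `0 < t < x`. -/
def appellF3Domain : Set (ℂ × ℂ) := Metric.ball 0 1 ×ˢ {v : ℂ | v.re < 1 / 2}

/-- `F` is a holomorphic continuation to `appellF3Domain` of the germ at the origin that is defined
by the double series of `F₃`. -/
def IsAppellF3 (a a' b b' c : ℂ) (F : ℂ × ℂ → ℂ) : Prop :=
  DifferentiableOn ℂ F appellF3Domain ∧
    ∀ᶠ z in 𝓝 (0 : ℂ × ℂ), F z = appellF3Series a a' b b' c z.1 z.2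

/-- The continuation is unique, so that the next definition does not depend on a choice. -/
theorem IsAppellF3.eqOn {a a' b b' c : ℂ} {F G : ℂ × ℂ → ℂ}
    (hF : IsAppellF3 a a' b b' c F) (hG : IsAppellF3 a a' b b' c G) :
    Set.EqOn F G appellF3Domain := by
  intro p hp
  have hconv : Convex ℝ appellF3Domain :=
    (convex_ball _ _).prod (convex_halfSpace_re_lt _)
  have hopen : IsOpen appellF3Domain :=
    Metric.isOpen_ball.prod (isOpen_lt Complex.continuous_re continuous_const)
  have h0 : (0 : ℂ × ℂ) ∈ appellF3Domain := by
    simp [appellF3Domain]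
  let L : ℂ →L[ℂ] ℂ × ℂ := ContinuousLinearMap.toSpanSingleton ℂ p
  have hL : ∀ z, L z = z • p := fun z => rfl
  have hUo : IsOpen (L ⁻¹' appellF3Domain) := hopen.preimage L.continuous
  have hUc : Convex ℝ (L ⁻¹' appellF3Domain) :=
    hconv.linear_preimage (L.restrictScalars ℝ).toLinearMap
  have hd : ∀ {H : ℂ × ℂ → ℂ}, DifferentiableOn ℂ H appellF3Domain →
      AnalyticOnNhd ℂ (fun z => H (L z)) (L ⁻¹' appellF3Domain) := fun {H} hH =>
    (hH.comp L.differentiable.differentiableOn (fun _ hz => hz)).analyticOnNhd hUo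
  have hL0 : Filter.Tendsto L (𝓝 0) (𝓝 0) := by
    simpa using L.continuous.tendsto 0
  have hev : (fun z => F (L z)) =ᶠ[𝓝 0] (fun z => G (L z)) := by
    filter_upwards [hL0.eventually hF.2, hL0.eventually hG.2] with z h1 h2
    rw [h1, h2]
  have := (hd hF.1).eqOn_of_preconnected_of_eventuallyEq (hd hG.1) hUc.isPreconnected
    (show (0 : ℂ) ∈ L ⁻¹' appellF3Domain by simpa using h0) hev
  have h1 := this (show (1 : ℂ) ∈ L ⁻¹' appellF3Domain by simpa [hL] using hp)
  simpa [hL] using h1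

/-- The third Appell function `F₃(a, a', b, b'; c; u, v)` for `|u| < 1`, `Re v < 1/2`: the value
at `(u, v)` of the holomorphic continuation of the double series. -/
def appellF3 (a a' b b' c u v : ℂ) : ℂ :=
  Classical.epsilon (IsAppellF3 a a' b b' c) (u, v)

/-- The integrand of the Marichev-Saigo-Maeda operator `I_{0,+}` at `x`. -/
def msmIntegrand (a a' b b' c : ℂ) (f : ℝ → ℂ) (x t : ℝ) : ℂ :=
  ((x - t : ℝ) : ℂ) ^ (c - 1) * (t : ℂ) ^ (-a') *
    appellF3 a a' b b' c (1 - (t : ℂ) / (x : ℂ)) (1 - (x : ℂ) / (t : ℂ)) * f t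

/-- The left-sided Marichev-Saigo-Maeda fractional integral
`(I_{0,+}^{a,a',b,b',c} f)(x)`, for `x > 0` and `Re c > 0`. -/
def msmIntegral (a a' b b' c : ℂ) (f : ℝ → ℂ) (x : ℝ) : ℂ :=
  (x : ℂ) ^ (-a) / Complex.Gamma c * ∫ t in (0 : ℝ)..x, msmIntegrand a a' b b' c f x t

/-- The quotient `Γ(a) Γ(b) Γ(c) / (Γ(d) Γ(e) Γ(f))`. -/
def gammaRatio (a b c d e f : ℂ) : ℂ :=
  (Complex.Gamma a * Complex.Gamma b * Complex.Gamma c) /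
    (Complex.Gamma d * Complex.Gamma e * Complex.Gamma f)

/-- The six upper parameters of the `₆F₇` series. -/
def upperParams (α α' β β' γ ρ : ℂ) : Fin 6 → ℂ :=
  ![ρ / 2, (ρ + 1) / 2,
    (ρ + γ - α - α' - β) / 2, (ρ + γ - α - α' - β + 1) / 2,
    (ρ + β' - α') / 2, (ρ + β' - α' + 1) / 2]

/-- The seven lower parameters of the `₆F₇` series. -/
def lowerParams (α α' β β' γ ρ : ℂ) : Fin 7 → ℂ :=
  ![1 / 2, (ρ + β') / 2, (ρ + β' + 1) / 2,
    (ρ + γ - α - α') / 2, (ρ + γ - α - α' + 1) / 2,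
    (ρ + γ - α' - β) / 2, (ρ + γ - α' - β + 1) / 2]

end

/-!
Write `δ = γ - β'`. Pfaff's transformation of `₂F₁`, applied to each power of `u` separately, gives
`F₃(α, α', β, β'; γ; u, v) = (1 - v) ^ (-α') ∑ A_{mn} u ^ m w ^ n` with `w = v / (v - 1)` and
`A_{mn} = (α)_m (β)_m (α')_n (δ + m)_n / ((γ)_{m + n} m! n!)` near the origin. As `|w| < 1` is the
same as `Re v < 1 / 2`, the right-hand side is the holomorphic continuation
(`isAppellF3_appellBivariate`). For `u = 1 - t / x` and `v = 1 - x / t` one has `w = u`, so on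
`(0, x)` the kernel of the fractional integral is, up to powers, `h (1 - t / x)`, where
`h u = ∑ A_{mn} u ^ (m + n)` is a function on the unit disc (`appellDiag`).

The image of `t ^ (ρ - 1)` is therefore a Mellin transform of `(1 - s) ^ (γ - 1) h (1 - s)` over
`(0, 1)`. If `Re α' > 0`, the double series may be integrated term by term against the Beta kernel,
and Gauss's theorem for `₂F₁(1)`, used for the sum over `n` and again for the sum over `m`,
evaluates the result as the quotient of Gamma functions (`integral_appellDiag_of_re_pos`). If `Re α' ≤ 0`, the
double series need not converge absolutely in the required range of `ρ`. In that case `h` is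
obtained from the function with parameters `α' + 1, γ + 1` (and the same `δ`) by a first-order differential
operator (`appellDiag_raise`). This operator preserves the bound `h = O(t ^ (-σ))` in nontangential
approach regions, by Cauchy's estimate, and on the Mellin side it is multiplication by `ρ + β'`, by
partial integration (`integral_mellinIntegrand_raise`). Since
`1 / Γ(ρ + β') = (ρ + β') / Γ(ρ + β' + 1)`, both the bound and the evaluation descend by induction
to all `α'` (`nontangentialGrowth_appellDiag`, `integral_mellinIntegrand_appellDiag`).

The power series of the cosine is then integrated term by term. It shifts `ρ` by `2 j`, and the
duplication formula turns the symbols `(a)_{2 j}` into the half-integral parameters of the `₆F₇`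
series. The case of the hyperbolic cosine is `cosh (c t) = cos (i c t)`.
-/

/-! ### Pochhammer symbols -/

theorem pochhammerC_zero (a : ℂ) : pochhammerC a 0 = 1 := by simp [pochhammerC]

theorem pochhammerC_succ (a : ℂ) (k : ℕ) :
    pochhammerC a (k + 1) = pochhammerC a k * (a + k) := by
  simp [pochhammerC, ascPochhammer_succ_eval]

theorem pochhammerC_succ_left (a : ℂ) (k : ℕ) :
    pochhammerC a (k + 1) = a * pochhammerC (a + 1) k := by
  simp [pochhammerC, ascPochhammer_succ_left]

theorem pochhammerC_add (a : ℂ) (m n : ℕ) :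
    pochhammerC a (m + n) = pochhammerC a m * pochhammerC (a + m) n := by
  induction n with
  | zero => simp [pochhammerC_zero]
  | succ n ih => rw [← add_assoc, pochhammerC_succ, ih, pochhammerC_succ]; push_cast; ring

theorem pochhammerC_eq_prod (a : ℂ) (k : ℕ) :
    pochhammerC a k = ∏ j ∈ Finset.range k, (a + j) := by
  induction k with
  | zero => simp [pochhammerC_zero]
  | succ k ih => rw [pochhammerC_succ, ih, Finset.prod_range_succ]

theorem pochhammerC_one (k : ℕ) : pochhammerC 1 k = (k.factorial : ℂ) := by
  simp [pochhammerC, ascPochhammer_eval_one]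

theorem add_natCast_ne_zero_of_re_pos {a : ℂ} (ha : 0 < a.re) (j : ℕ) : a + j ≠ 0 := by
  intro h
  have := congrArg Complex.re h
  simp at this
  linarith [(Nat.cast_nonneg j : (0 : ℝ) ≤ j)]

theorem pochhammerC_ne_zero {a : ℂ} (ha : ∀ j : ℕ, a + j ≠ 0) (k : ℕ) : pochhammerC a k ≠ 0 := by
  rw [pochhammerC_eq_prod]
  exact Finset.prod_ne_zero_iff.2 fun j _ => ha j

/-- The duplication formula for the Pochhammer symbol. -/
theorem pochhammerC_two_mul (a : ℂ) (k : ℕ) :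
    pochhammerC a (2 * k) = 4 ^ k * pochhammerC (a / 2) k * pochhammerC ((a + 1) / 2) k := by
  induction k with
  | zero => simp [pochhammerC_zero]
  | succ k ih =>
    rw [show 2 * (k + 1) = 2 * k + 1 + 1 by ring, pochhammerC_succ, pochhammerC_succ, ih,
      pochhammerC_succ, pochhammerC_succ, pow_succ]
    push_cast
    ring

/-- The functional equation of `1 / Γ`, valid at the poles of `Γ` as well. -/
theorem inv_Gamma_eq_pochhammerC_mul (a : ℂ) (k : ℕ) :
    (Complex.Gamma a)⁻¹ = pochhammerC a k * (Complex.Gamma (a + k))⁻¹ := by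
  induction k with
  | zero => simp [pochhammerC_zero]
  | succ k ih =>
    rw [ih, Complex.one_div_Gamma_eq_self_mul_one_div_Gamma_add_one (a + k), pochhammerC_succ]
    push_cast
    ring_nf

theorem Gamma_add_natCast {a : ℂ} (ha : ∀ j : ℕ, a ≠ -j) (k : ℕ) :
    Complex.Gamma (a + k) = Complex.Gamma a * pochhammerC a k := by
  have h := inv_Gamma_eq_pochhammerC_mul a k
  have h1 := Complex.Gamma_ne_zero ha
  have h2 : Complex.Gamma (a + k) ≠ 0 := by
    intro h0
    rw [h0, inv_zero, mul_zero] at h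
    exact inv_ne_zero h1 h
  field_simp at h
  rw [h]

theorem ne_neg_natCast_of_re_pos {a : ℂ} (ha : 0 < a.re) (j : ℕ) : a ≠ -j := by
  intro h
  exact add_natCast_ne_zero_of_re_pos ha j (by rw [h]; ring)

theorem pochhammerC_ofReal_eq_norm {a : ℝ} (ha : 0 ≤ a) (k : ℕ) :
    pochhammerC (a : ℂ) k = (‖pochhammerC (a : ℂ) k‖ : ℂ) := by
  rw [pochhammerC_eq_prod, norm_prod]
  push_cast
  refine Finset.prod_congr rfl fun j _ => ?_
  rw [← Complex.ofReal_natCast, ← Complex.ofReal_add, Complex.norm_real,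
    Real.norm_of_nonneg (by positivity)]

theorem norm_pochhammerC_ofReal_le {r : ℝ} {z : ℂ} (hr : 0 ≤ r) (hz : r ≤ z.re) (k : ℕ) :
    ‖pochhammerC (r : ℂ) k‖ ≤ ‖pochhammerC z k‖ := by
  rw [pochhammerC_eq_prod, pochhammerC_eq_prod, norm_prod, norm_prod]
  refine Finset.prod_le_prod (fun _ _ => norm_nonneg _) fun j _ => ?_
  rw [← Complex.ofReal_natCast, ← Complex.ofReal_add, Complex.norm_real,
    Real.norm_of_nonneg (by positivity)]
  have := Complex.re_le_norm (z + j)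
  simp at this ⊢
  linarith

/-! ### Growth of Pochhammer symbols -/

theorem eventually_norm_add_natCast_le (z w : ℂ) {q : ℝ} (hq : 1 < q) :
    ∀ᶠ j : ℕ in Filter.atTop, ‖z + j‖ ≤ q * ‖w + j‖ := by
  have h : Filter.Tendsto (fun j : ℕ => ‖w + j‖) Filter.atTop Filter.atTop := by
    refine Filter.tendsto_atTop_mono (f := fun j : ℕ => (j : ℝ) - ‖w‖) (fun j => ?_)
      (Filter.tendsto_atTop_add_const_right _ _ tendsto_natCast_atTop_atTop)
    have := norm_sub_norm_le (j : ℂ) (-w)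
    rw [norm_neg, sub_neg_eq_add, Complex.norm_natCast, add_comm] at this
    exact this
  filter_upwards [h.eventually_ge_atTop (‖z - w‖ / (q - 1))] with j hj
  rw [div_le_iff₀ (by linarith)] at hj
  have := norm_add_le (z - w) (w + j)
  rw [show z - w + (w + j) = z + j by ring] at this
  nlinarith

theorem eventually_norm_add_natCast_le_add (z : ℂ) {d : ℝ} (hd : z.re < d) :
    ∀ᶠ j : ℕ in Filter.atTop, ‖z + j‖ ≤ d + j := by
  have h := (tendsto_natCast_atTop_atTop (R := ℝ)).eventually_ge_atTop
    (|d| + |z.re| + z.im ^ 2 / (d - z.re))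
  filter_upwards [h] with j hj
  have hp : 0 < d - z.re := by linarith
  have h0 : 0 ≤ z.im ^ 2 / (d - z.re) := by positivity
  have h1 := neg_abs_le d
  have h2 := neg_abs_le z.re
  have h3 : z.im ^ 2 ≤ (d - z.re) * (d + z.re + 2 * j) := by
    have h4 : z.im ^ 2 / (d - z.re) ≤ d + z.re + 2 * j := by
      linarith [abs_nonneg d, abs_nonneg z.re]
    rw [div_le_iff₀ hp] at h4
    linarith
  refine abs_le_of_sq_le_sq' ?_ (by linarith [abs_nonneg z.re]) |>.2
  rw [Complex.sq_norm, Complex.normSq_apply]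
  simp
  nlinarith

/-- If `‖z + j‖ ≤ q ‖w + j‖` for all large `j`, then the quotient of the Pochhammer symbols of
`z + m` and `w + m` is `O(q ^ n)`, uniformly in the shift `m`. -/
theorem exists_norm_pochhammerC_add_le {z w : ℂ} {q : ℝ} (hq : 0 < q) (hw : ∀ j : ℕ, w + j ≠ 0)
    (h : ∀ᶠ j : ℕ in Filter.atTop, ‖z + j‖ ≤ q * ‖w + j‖) :
    ∃ C : ℝ, 0 < C ∧ ∀ m n : ℕ,
      ‖pochhammerC (z + m) n‖ ≤ C * q ^ n * ‖pochhammerC (w + m) n‖ := by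
  obtain ⟨j₀, hj₀⟩ := Filter.eventually_atTop.1 h
  set R : ℕ → ℝ := fun j => max 1 (‖z + j‖ / (q * ‖w + j‖)) with hR
  have hpos : ∀ j : ℕ, 0 < q * ‖w + j‖ := fun j => mul_pos hq (norm_pos_iff.2 (hw j))
  have hR1 : ∀ j : ℕ, 1 ≤ R j := fun j => le_max_left _ _
  have hRz : ∀ j : ℕ, ‖z + j‖ ≤ R j * (q * ‖w + j‖) := fun j =>
    (div_le_iff₀ (hpos j)).1 (le_max_right _ _)
  have hR0 : ∀ j : ℕ, j₀ ≤ j → R j = 1 := fun j hj =>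
    max_eq_left ((div_le_one (hpos j)).2 (hj₀ j hj))
  have hC : ∀ S : Finset ℕ, ∏ j ∈ S, R j ≤ ∏ j ∈ Finset.range j₀, R j := by
    intro S
    calc ∏ j ∈ S, R j ≤ ∏ j ∈ S ∪ Finset.range j₀, R j := by
          rw [← Finset.prod_sdiff (Finset.subset_union_left (s₁ := S) (s₂ := Finset.range j₀))]
          refine le_mul_of_one_le_left
            (Finset.prod_nonneg fun j _ => zero_le_one.trans (hR1 j)) ?_
          exact Finset.prod_induction _ (fun x => (1 : ℝ) ≤ x)
            (fun _ _ => one_le_mul_of_one_le_of_one_le) le_rfl fun j _ => hR1 j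
      _ = ∏ j ∈ Finset.range j₀, R j := by
          refine (Finset.prod_subset Finset.subset_union_right fun j _ hj => hR0 j ?_).symm
          simpa using hj
  refine ⟨∏ j ∈ Finset.range j₀, R j,
    Finset.prod_pos fun j _ => lt_of_lt_of_le one_pos (hR1 j), fun m n => ?_⟩
  have hmap : ∏ j ∈ Finset.range n, R (m + j) =
      ∏ j ∈ (Finset.range n).map (addLeftEmbedding m), R j := by
    simp
  calc ‖pochhammerC (z + m) n‖ = ∏ j ∈ Finset.range n, ‖z + ((m + j : ℕ) : ℂ)‖ := by
        rw [pochhammerC_eq_prod, norm_prod]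
        exact Finset.prod_congr rfl fun j _ => by push_cast; rw [add_assoc]
    _ ≤ ∏ j ∈ Finset.range n, (R (m + j) * (q * ‖w + ((m + j : ℕ) : ℂ)‖)) :=
        Finset.prod_le_prod (fun _ _ => norm_nonneg _) fun j _ => hRz _
    _ = (∏ j ∈ Finset.range n, R (m + j)) * q ^ n * ‖pochhammerC (w + m) n‖ := by
        rw [Finset.prod_mul_distrib, Finset.prod_mul_distrib, Finset.prod_const,
          Finset.card_range, pochhammerC_eq_prod, norm_prod, mul_assoc]
        congr 2
        exact Finset.prod_congr rfl fun j _ => by push_cast; rw [add_assoc]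
    _ ≤ _ := by
        rw [hmap]
        exact mul_le_mul_of_nonneg_right (mul_le_mul_of_nonneg_right (hC _) (by positivity))
          (norm_nonneg _)

/-- **Raabe's test.** -/
theorem summable_of_raabe {t : ℕ → ℝ} {ε : ℝ} (hε : 0 < ε) (ht : ∀ n, 0 ≤ t n)
    (h : ∀ᶠ n : ℕ in Filter.atTop, (n + 1) * t (n + 1) ≤ (n - ε) * t n) : Summable t := by
  obtain ⟨N, hN⟩ := Filter.eventually_atTop.1 h
  rw [← summable_nat_add_iff N]
  refine summable_of_sum_range_le (c := N * t N / ε) (fun n => ht _) fun n => ?_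
  rw [le_div_iff₀ hε]
  have key : (∑ i ∈ Finset.range n, t (i + N)) * ε ≤ N * t N - ((n + N : ℕ) : ℝ) * t (n + N) := by
    induction n with
    | zero => simp
    | succ n ih =>
      have := hN (n + N) (by omega)
      rw [Finset.sum_range_succ, add_mul, show n + 1 + N = n + N + 1 by ring]
      push_cast at this ih ⊢
      linarith
  have : 0 ≤ ((n + N : ℕ) : ℝ) * t (n + N) := mul_nonneg (Nat.cast_nonneg _) (ht _)
  linarith

/-- A nonzero limit would make `t` comparable with the harmonic series. -/
theorem eq_zero_of_tendsto_natCast_mul {t : ℕ → ℂ} (ht : Summable t) {L : ℂ}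
    (h : Filter.Tendsto (fun n : ℕ => n * t n) Filter.atTop (𝓝 L)) : L = 0 := by
  by_contra hL
  have hL' : 0 < ‖L‖ := norm_pos_iff.2 hL
  have h1 : ∀ᶠ n : ℕ in Filter.atTop, ‖L‖ / 2 < ‖(n : ℂ) * t n‖ :=
    h.norm.eventually_const_lt (by linarith)
  refine Real.not_summable_one_div_natCast
    (summable_of_isBigO_nat ht.norm (Asymptotics.IsBigO.of_bound (2 / ‖L‖) ?_))
  filter_upwards [h1, Filter.eventually_gt_atTop 0] with n hn hn0
  have hn1 : (0 : ℝ) < n := Nat.cast_pos.2 hn0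
  rw [norm_mul, Complex.norm_natCast] at hn
  rw [Real.norm_of_nonneg (by positivity), Real.norm_of_nonneg (norm_nonneg _),
    div_mul_eq_mul_div, div_le_div_iff₀ hn1 hL']
  nlinarith

/-! ### Gauss's theorem -/

/-- The `n`-th term of the regularized Gauss series `₂F₁(a, b; c; 1) / Γ(c)`. -/
noncomputable def gaussTerm (a b c : ℂ) (n : ℕ) : ℂ :=
  pochhammerC a n * pochhammerC b n / (n.factorial : ℂ) * (Complex.Gamma (c + n))⁻¹

theorem gaussTerm_succ (a b c : ℂ) {n : ℕ} (hc : c + n ≠ 0) :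
    ((n : ℂ) + 1) * gaussTerm a b c (n + 1) =
      (a + n) * (b + n) / (c + n) * gaussTerm a b c n := by
  have h : (Complex.Gamma (c + n))⁻¹ = (c + n) * (Complex.Gamma (c + (n + 1 : ℕ)))⁻¹ := by
    rw [Complex.one_div_Gamma_eq_self_mul_one_div_Gamma_add_one (c + n)]
    push_cast; ring_nf
  have hn : (n : ℂ) + 1 ≠ 0 := by exact_mod_cast n.succ_ne_zero
  have hf : (n.factorial : ℂ) ≠ 0 := by exact_mod_cast n.factorial_ne_zero
  rw [gaussTerm, gaussTerm, h, pochhammerC_succ, pochhammerC_succ, Nat.factorial_succ]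
  push_cast
  field_simp

theorem summable_norm_gaussTerm {a b c : ℂ} (h : a.re + b.re < c.re) :
    Summable fun n => ‖gaussTerm a b c n‖ := by
  obtain ⟨ε, hε, hc⟩ : ∃ ε : ℝ, 0 < ε ∧ c.re = a.re + b.re + 4 * ε :=
    ⟨(c.re - a.re - b.re) / 4, by linarith, by ring⟩
  refine summable_of_raabe hε (fun _ => norm_nonneg _) ?_
  have hlarge := (tendsto_natCast_atTop_atTop (R := ℝ)).eventually_gt_atTop
    (max ε (max (-c.re) (((a.re + ε) * (b.re + ε) + ε * c.re) / ε)))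
  filter_upwards [eventually_norm_add_natCast_le_add a (show a.re < a.re + ε by linarith),
    eventually_norm_add_natCast_le_add b (show b.re < b.re + ε by linarith), hlarge]
    with n h1 h2 h3
  rw [max_lt_iff, max_lt_iff, div_lt_iff₀ hε] at h3
  obtain ⟨h3, h4, h5⟩ := h3
  have hre : (c + n).re = c.re + n := by simp
  have hcn : 0 < ‖c + n‖ := by
    refine lt_of_lt_of_le ?_ (Complex.re_le_norm _)
    rw [hre]; linarith
  have hcn' : c.re + n ≤ ‖c + n‖ := hre ▸ Complex.re_le_norm _
  have e := congrArg norm (gaussTerm_succ a b c (norm_pos_iff.1 hcn))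
  rw [norm_mul, norm_mul, norm_div, norm_mul] at e
  have e2 : ‖(n : ℂ) + 1‖ = n + 1 := by
    rw [← Nat.cast_add_one, Complex.norm_natCast]; push_cast; rfl
  rw [e2] at e
  rw [e]
  refine mul_le_mul_of_nonneg_right ?_ (norm_nonneg _)
  rw [div_le_iff₀ hcn]
  calc ‖a + n‖ * ‖b + n‖ ≤ (a.re + ε + n) * (b.re + ε + n) :=
        mul_le_mul h1 h2 (norm_nonneg _) ((norm_nonneg _).trans h1)
    _ ≤ (n - ε) * (c.re + n) := by nlinarith
    _ ≤ _ := mul_le_mul_of_nonneg_left hcn' (by linarith)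

theorem summable_gaussTerm {a b c : ℂ} (h : a.re + b.re < c.re) :
    Summable (gaussTerm a b c) :=
  (summable_norm_gaussTerm h).of_norm

/-- Contiguity in the lower parameter. The difference of the two sides telescopes: it is the sum
of `v (n + 1) - v n` for `v n = n * gaussTerm a b c n`, and `v` tends to `0`. -/
theorem tsum_gaussTerm_add_one {a b c : ℂ} (h : a.re + b.re < c.re) :
    (c - a) * (c - b) * ∑' n, gaussTerm a b (c + 1) n =
      (c - a - b) * ∑' n, gaussTerm a b c n := by
  have h' : a.re + b.re < (c + 1).re := by simp; linarith
  set v : ℕ → ℂ := fun n => n * gaussTerm a b c n with hv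
  have hstep : ∀ n, v (n + 1) - v n =
      (c - a) * (c - b) * gaussTerm a b (c + 1) n - (c - a - b) * gaussTerm a b c n := by
    intro n
    have h1 : (Complex.Gamma (c + n))⁻¹ = (c + n) * (Complex.Gamma (c + 1 + n))⁻¹ := by
      rw [Complex.one_div_Gamma_eq_self_mul_one_div_Gamma_add_one (c + n)]
      ring_nf
    have hn : (n : ℂ) + 1 ≠ 0 := by exact_mod_cast n.succ_ne_zero
    have hf : (n.factorial : ℂ) ≠ 0 := by exact_mod_cast n.factorial_ne_zero
    simp only [hv, gaussTerm]
    rw [h1, pochhammerC_succ, pochhammerC_succ, Nat.factorial_succ,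
      show c + ((n + 1 : ℕ) : ℂ) = c + 1 + n by push_cast; ring]
    push_cast
    field_simp
    ring
  have hsum := (((summable_gaussTerm h').hasSum.mul_left ((c - a) * (c - b))).sub
    ((summable_gaussTerm h).hasSum.mul_left (c - a - b)))
  have htend := hsum.tendsto_sum_nat
  simp only [← hstep, Finset.sum_range_sub] at htend
  have hv0 : v 0 = 0 := by simp [hv]
  rw [hv0] at htend
  simp only [sub_zero] at htend
  exact sub_eq_zero.1 (eq_zero_of_tendsto_natCast_mul (summable_gaussTerm h) htend)

/-- As the lower parameter tends to infinity, only the term `n = 0` of `₂F₁` survives. -/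
theorem tendsto_Gamma_mul_tsum_gaussTerm {a b c : ℂ} (h : a.re + b.re < c.re) (hc : 0 < c.re) :
    Filter.Tendsto (fun N : ℕ => Complex.Gamma (c + N) * ∑' n, gaussTerm a b (c + N) n)
      Filter.atTop (𝓝 1) := by
  have hre : ∀ N : ℕ, 0 < (c + N).re := fun N => by simp; positivity
  have hterm : ∀ N n : ℕ, Complex.Gamma (c + N) * gaussTerm a b (c + N) n =
      pochhammerC a n * pochhammerC b n / (n.factorial : ℂ) * (pochhammerC (c + N) n)⁻¹ := by
    intro N n
    rw [gaussTerm, Gamma_add_natCast (ne_neg_natCast_of_re_pos (hre N))]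
    have := Complex.Gamma_ne_zero_of_re_pos (hre N)
    rw [mul_inv]
    field_simp
  simp_rw [← tsum_mul_left, hterm]
  have hsum : Summable fun n : ℕ =>
      ‖pochhammerC a n * pochhammerC b n / (n.factorial : ℂ) * (pochhammerC (c.re : ℂ) n)⁻¹‖ := by
    have h1 := (summable_norm_gaussTerm (a := a) (b := b) (c := (c.re : ℂ))
      (by simpa using h)).mul_left
      ‖Complex.Gamma (c.re : ℂ)‖
    refine h1.congr fun n => ?_
    have hc' : 0 < (c.re : ℂ).re := by simpa using hc
    have := Complex.Gamma_ne_zero_of_re_pos hc'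
    rw [← norm_mul, gaussTerm, Gamma_add_natCast (ne_neg_natCast_of_re_pos hc'), mul_inv]
    congr 1
    field_simp
  have hlim : ∀ n : ℕ, Filter.Tendsto (fun N : ℕ => pochhammerC a n * pochhammerC b n /
      (n.factorial : ℂ) * (pochhammerC (c + N) n)⁻¹) Filter.atTop
      (𝓝 (if n = 0 then 1 else 0)) := by
    intro n
    have h1 : Filter.Tendsto (fun N : ℕ => (pochhammerC (c + N) n)⁻¹) Filter.atTop
        (𝓝 (∏ _j ∈ Finset.range n, 0)) := by
      simp_rw [pochhammerC_eq_prod, ← Finset.prod_inv_distrib]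
      refine tendsto_finsetProd _ fun j _ => ?_
      refine (Filter.tendsto_inv₀_cobounded (α := ℂ)).comp ?_
      rw [← tendsto_norm_atTop_iff_cobounded]
      refine Filter.tendsto_atTop_mono (f := fun N : ℕ => (N : ℝ)) (fun N => ?_)
        tendsto_natCast_atTop_atTop
      refine le_trans ?_ (Complex.re_le_norm _)
      have : (0 : ℝ) ≤ j := Nat.cast_nonneg _
      simp
      linarith
    have h2 := h1.const_mul (pochhammerC a n * pochhammerC b n / (n.factorial : ℂ))
    convert h2 using 2
    rcases n with _ | n <;> simp [pochhammerC_zero]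
  have key := tendsto_tsum_of_dominated_convergence hsum hlim (Filter.Eventually.of_forall
    fun N n => by
      rw [norm_mul, norm_mul _ (pochhammerC (c.re : ℂ) n)⁻¹, norm_inv, norm_inv]
      refine mul_le_mul_of_nonneg_left ?_ (norm_nonneg _)
      have h0 : 0 < ‖pochhammerC (c.re : ℂ) n‖ := norm_pos_iff.2
        (pochhammerC_ne_zero (add_natCast_ne_zero_of_re_pos (by simpa using hc)) n)
      exact inv_anti₀ h0 (norm_pochhammerC_ofReal_le hc.le (by simp) n))
  simpa using key

theorem Gamma_add_natCast_eq_GammaSeq {s : ℂ} (hs : 0 < s.re) {n : ℕ} (hn : n ≠ 0) :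
    Complex.Gamma (s + (n + 1 : ℕ)) =
      Complex.Gamma s * ((n : ℂ) ^ s * (n.factorial : ℂ)) * (Complex.GammaSeq s n)⁻¹ := by
  have h : Complex.GammaSeq s n = (n : ℂ) ^ s * (n.factorial : ℂ) / pochhammerC s (n + 1) := by
    rw [Complex.GammaSeq, pochhammerC_eq_prod]
  have h1 := pochhammerC_ne_zero (add_natCast_ne_zero_of_re_pos hs) (n + 1)
  have h2 : (n : ℂ) ^ s ≠ 0 := by
    rw [Ne, Complex.cpow_eq_zero_iff]; simp [hn]
  have hf : (n.factorial : ℂ) ≠ 0 := by exact_mod_cast n.factorial_ne_zero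
  rw [Gamma_add_natCast (ne_neg_natCast_of_re_pos hs), h]
  field_simp

/-- `Γ(s) Γ(s - a - b) / (Γ(s - a) Γ(s - b))` tends to `1` along `s = c + N + 1`: the powers
`n ^ s` in the limit formula for `Γ` cancel. -/
theorem tendsto_Gamma_ratio {a b c : ℂ} (h : 0 < c.re) (ha : 0 < (c - a).re)
    (hb : 0 < (c - b).re) (hab : 0 < (c - a - b).re) :
    Filter.Tendsto (fun n : ℕ => Complex.Gamma (c + (n + 1 : ℕ)) *
      (Complex.Gamma (c - a - b + (n + 1 : ℕ)) * ((Complex.Gamma (c - a + (n + 1 : ℕ)))⁻¹ *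
        (Complex.Gamma (c - b + (n + 1 : ℕ)))⁻¹))) Filter.atTop (𝓝 1) := by
  have G0 := Complex.Gamma_ne_zero_of_re_pos h
  have Ga := Complex.Gamma_ne_zero_of_re_pos ha
  have Gb := Complex.Gamma_ne_zero_of_re_pos hb
  have Gab := Complex.Gamma_ne_zero_of_re_pos hab
  have hlim := (((Complex.GammaSeq_tendsto_Gamma c).inv₀ G0).mul
    ((Complex.GammaSeq_tendsto_Gamma (c - a - b)).inv₀ Gab)).mul
    ((Complex.GammaSeq_tendsto_Gamma (c - a)).mul (Complex.GammaSeq_tendsto_Gamma (c - b)))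
  have hlim2 := hlim.const_mul (Complex.Gamma c * Complex.Gamma (c - a - b) *
    ((Complex.Gamma (c - a))⁻¹ * (Complex.Gamma (c - b))⁻¹))
  have e1 : Complex.Gamma c * Complex.Gamma (c - a - b) *
    ((Complex.Gamma (c - a))⁻¹ * (Complex.Gamma (c - b))⁻¹) * ((Complex.Gamma c)⁻¹ *
      (Complex.Gamma (c - a - b))⁻¹ * (Complex.Gamma (c - a) * Complex.Gamma (c - b))) = 1 := by
    field_simp
  rw [e1] at hlim2
  refine hlim2.congr' ?_
  filter_upwards [Filter.eventually_ne_atTop 0] with n hn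
  have hn' : (n : ℂ) ≠ 0 := by exact_mod_cast hn
  have hf : (n.factorial : ℂ) ≠ 0 := by exact_mod_cast n.factorial_ne_zero
  rw [Gamma_add_natCast_eq_GammaSeq h hn, Gamma_add_natCast_eq_GammaSeq ha hn,
    Gamma_add_natCast_eq_GammaSeq hb hn, Gamma_add_natCast_eq_GammaSeq hab hn]
  have e2 : (n : ℂ) ^ c * (n : ℂ) ^ (c - a - b) *
      (((n : ℂ) ^ (c - a))⁻¹ * ((n : ℂ) ^ (c - b))⁻¹) = 1 := by
    rw [← Complex.cpow_neg, ← Complex.cpow_neg, ← Complex.cpow_add _ _ hn',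
      ← Complex.cpow_add _ _ hn', ← Complex.cpow_add _ _ hn']
    ring_nf
    simp
  generalize (n : ℂ) ^ c = A at *
  generalize (n : ℂ) ^ (c - a - b) = B at *
  generalize (n : ℂ) ^ (c - a) = C at *
  generalize (n : ℂ) ^ (c - b) = D at *
  simp only [mul_inv, inv_inv]
  have e3 : (n.factorial : ℂ) * n.factorial * ((n.factorial : ℂ)⁻¹ * (n.factorial : ℂ)⁻¹) = 1 := by
    field_simp
  linear_combination (-(Complex.Gamma c * Complex.Gamma (c - a - b) *
    ((Complex.Gamma (c - a))⁻¹ * (Complex.Gamma (c - b))⁻¹) *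
    ((Complex.GammaSeq c n)⁻¹ * (Complex.GammaSeq (c - a - b) n)⁻¹ *
      (Complex.GammaSeq (c - a) n * Complex.GammaSeq (c - b) n)))) *
    (e2 * (n.factorial : ℂ) * n.factorial * ((n.factorial : ℂ)⁻¹ * (n.factorial : ℂ)⁻¹) + e3)

/-- **Gauss's theorem** for `₂F₁(a, b; c; 1) / Γ(c)`. No parameter has to avoid the poles of `Γ`,
as `1 / Γ` vanishes there both in fact and by the convention `0⁻¹ = 0`. -/
theorem tsum_gaussTerm {a b c : ℂ} (h : a.re + b.re < c.re) :
    ∑' n, gaussTerm a b c n =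
      Complex.Gamma (c - a - b) * ((Complex.Gamma (c - a))⁻¹ * (Complex.Gamma (c - b))⁻¹) := by
  set S : ℂ → ℂ := fun c => ∑' n, gaussTerm a b c n with hS
  set G : ℂ → ℂ := fun c => Complex.Gamma (c - a - b) *
    ((Complex.Gamma (c - a))⁻¹ * (Complex.Gamma (c - b))⁻¹) with hG
  have hne : ∀ c : ℂ, a.re + b.re < c.re → c - a - b ≠ 0 := by
    intro c hc h0
    have := congrArg Complex.re h0
    simp at this
    linarith
  have recS : ∀ c : ℂ, a.re + b.re < c.re →
      S c = (c - a) * (c - b) / (c - a - b) * S (c + 1) := by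
    intro c hc
    rw [div_mul_eq_mul_div, eq_div_iff (hne c hc), hS]
    simp only
    rw [tsum_gaussTerm_add_one hc, mul_comm]
  have recG : ∀ c : ℂ, a.re + b.re < c.re →
      G c = (c - a) * (c - b) / (c - a - b) * G (c + 1) := by
    intro c hc
    simp only [hG]
    rw [Complex.one_div_Gamma_eq_self_mul_one_div_Gamma_add_one (c - a),
      Complex.one_div_Gamma_eq_self_mul_one_div_Gamma_add_one (c - b),
      show c + 1 - a - b = c - a - b + 1 by ring, Complex.Gamma_add_one _ (hne c hc),
      show c + 1 - a = c - a + 1 by ring, show c + 1 - b = c - b + 1 by ring]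
    have := hne c hc
    field_simp
  have hadd : ∀ (c : ℂ) (N : ℕ), a.re + b.re < c.re → a.re + b.re < (c + N).re := by
    intro c N hc
    have : (0 : ℝ) ≤ N := Nat.cast_nonneg _
    simp; linarith
  -- `S / G` has period one; a common factor is used because `G` may vanish
  have hper : ∀ (N : ℕ) (c : ℂ), a.re + b.re < c.re → ∃ r : ℂ,
      S c = r * S (c + N) ∧ G c = r * G (c + N) := by
    intro N
    induction N with
    | zero => intro c _; exact ⟨1, by simp, by simp⟩
    | succ N ih =>
      intro c hc
      obtain ⟨r, h1, h2⟩ := ih c hc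
      refine ⟨r * ((c + N - a) * (c + N - b) / (c + N - a - b)), ?_, ?_⟩
      · rw [h1, recS _ (hadd c N hc)]; push_cast; ring_nf
      · rw [h2, recG _ (hadd c N hc)]; push_cast; ring_nf
  have hbig : ∀ c : ℂ, a.re + b.re < c.re → 0 < c.re → 0 < (c - a).re → 0 < (c - b).re →
      S c = G c := by
    intro c hc h0 ha hb
    have hab : 0 < (c - a - b).re := by simp; linarith
    have h1 := (tendsto_Gamma_mul_tsum_gaussTerm hc h0).comp (Filter.tendsto_add_atTop_nat 1)
    have h2 := tendsto_Gamma_ratio h0 ha hb hab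
    have Gne : G c ≠ 0 := mul_ne_zero (Complex.Gamma_ne_zero_of_re_pos hab)
      (mul_ne_zero (inv_ne_zero (Complex.Gamma_ne_zero_of_re_pos ha))
        (inv_ne_zero (Complex.Gamma_ne_zero_of_re_pos hb)))
    have h3 : ∀ N : ℕ, Complex.Gamma (c + (N + 1 : ℕ)) * S (c + (N + 1 : ℕ)) =
        S c / G c * (Complex.Gamma (c + (N + 1 : ℕ)) *
      (Complex.Gamma (c - a - b + (N + 1 : ℕ)) * ((Complex.Gamma (c - a + (N + 1 : ℕ)))⁻¹ *
        (Complex.Gamma (c - b + (N + 1 : ℕ)))⁻¹))) := by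
      intro N
      obtain ⟨r, hr1, hr2⟩ := hper (N + 1) c hc
      have hr : r ≠ 0 := by rintro rfl; exact Gne (by simpa using hr2)
      have hG' : G (c + (N + 1 : ℕ)) = Complex.Gamma (c - a - b + (N + 1 : ℕ)) *
          ((Complex.Gamma (c - a + (N + 1 : ℕ)))⁻¹ * (Complex.Gamma (c - b + (N + 1 : ℕ)))⁻¹) := by
        simp only [hG]; ring_nf
      rw [← hG', hr1, hr2]
      rw [hr2] at Gne
      have := right_ne_zero_of_mul Gne
      field_simp
    have h4 := h2.const_mul (S c / G c)
    have h5 := tendsto_nhds_unique h1 (h4.congr fun N => (h3 N).symm)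
    rw [mul_one] at h5
    field_simp at h5
    exact h5.symm
  obtain ⟨N, hN⟩ := exists_nat_gt (max (-c.re) (max (a.re - c.re) (b.re - c.re)))
  rw [max_lt_iff, max_lt_iff] at hN
  obtain ⟨r, h1, h2⟩ := hper N c h
  change S c = G c
  rw [h1, h2, hbig (c + N) (hadd c N h) (by simp; linarith) (by simp; linarith)
    (by simp; linarith)]

/-! ### The binomial series and Pfaff's transformation -/

/-- The binomial series `(1 - v) ^ (-a) = ∑ (a)_k v ^ k / k!`. -/
theorem hasSum_one_sub_cpow_neg (a : ℂ) {v : ℂ} (hv : ‖v‖ < 1) :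
    HasSum (fun k : ℕ => pochhammerC a k / (k.factorial : ℂ) * v ^ k) ((1 - v) ^ (-a)) := by
  have h := (Complex.one_div_one_sub_cpow_hasFPowerSeriesOnBall_zero a).hasSum (y := v)
    (by simpa [enorm_eq_nnnorm, ← NNReal.coe_lt_coe] using hv)
  simp only [FormalMultilinearSeries.ofScalars_apply_eq, zero_add, smul_eq_mul, one_div,
    ← Complex.cpow_neg] at h
  refine h.congr_fun fun k => ?_
  congr 1
  have hf : (k.factorial : ℂ) ≠ 0 := by exact_mod_cast k.factorial_ne_zero
  rw [Ring.choose, div_eq_iff hf]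
  have := Ring.factorial_nsmul_multichoose_eq_ascPochhammer (a + k - 1 - k + 1) k
  rw [Polynomial.ascPochhammer_smeval_eq_eval, nsmul_eq_mul] at this
  rw [mul_comm, this, pochhammerC]
  ring_nf

/-- The Chu–Vandermonde identity. -/
theorem sum_choose_mul_pochhammerC (e c : ℂ) (N : ℕ) :
    ∑ n ∈ Finset.range (N + 1), (-1) ^ n * (N.choose n : ℂ) * pochhammerC e n *
      pochhammerC (c + n) (N - n) = pochhammerC (c - e) N := by
  induction N generalizing c with
  | zero => simp [pochhammerC_zero]
  | succ N ih =>
    have hsplit : ∑ n ∈ Finset.range (N + 1 + 1), (-1) ^ n * ((N + 1).choose n : ℂ) *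
        pochhammerC e n * pochhammerC (c + n) (N + 1 - n) =
        (∑ n ∈ Finset.range (N + 1), (-1) ^ n * (N.choose n : ℂ) *
          pochhammerC e n * pochhammerC (c + n) (N + 1 - n)) +
        ∑ n ∈ Finset.range (N + 1), (-1) ^ (n + 1) * (N.choose n : ℂ) *
          pochhammerC e (n + 1) * pochhammerC (c + (n + 1 : ℕ)) (N + 1 - (n + 1)) := by
      have h1 : ∑ n ∈ Finset.range (N + 1), (-1) ^ n * (N.choose n : ℂ) *
          pochhammerC e n * pochhammerC (c + n) (N + 1 - n) =
          ∑ n ∈ Finset.range (N + 1 + 1), (-1) ^ n * (N.choose n : ℂ) *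
          pochhammerC e n * pochhammerC (c + n) (N + 1 - n) := by
        rw [Finset.sum_range_succ _ (N + 1)]
        simp
      rw [h1, Finset.sum_range_succ' _ (N + 1), Finset.sum_range_succ' _ (N + 1), add_right_comm,
        ← Finset.sum_add_distrib]
      congr 1
      · refine Finset.sum_congr rfl fun n _ => ?_
        rw [Nat.choose_succ_succ]
        push_cast
        ring
      · simp
    rw [hsplit, ← Finset.sum_add_distrib, pochhammerC_succ_left,
      show c - e + 1 = c + 1 - e by ring, ← ih, Finset.mul_sum]
    refine Finset.sum_congr rfl fun n hn => ?_
    have hn' : n ≤ N := Nat.lt_succ_iff.1 (Finset.mem_range.1 hn)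
    rw [Nat.succ_sub hn', pochhammerC_succ_left, pochhammerC_succ, Nat.succ_sub_succ,
      show c + ((n + 1 : ℕ) : ℂ) = c + 1 + n by push_cast; ring,
      show c + n + 1 = c + 1 + n by ring]
    ring

theorem tsum_prod_eq_tsum_sum_antidiagonal {f : ℕ × ℕ → ℂ} (hf : Summable f) :
    ∑' p, f p = ∑' N, ∑ p ∈ Finset.HasAntidiagonal.antidiagonal N, f p := by
  rw [← Finset.HasAntidiagonal.sigmaAntidiagonalEquivProd.tsum_eq f]
  refine (Summable.tsum_sigma' (fun N => (hasSum_fintype _).summable)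
    (Finset.HasAntidiagonal.sigmaAntidiagonalEquivProd.summable_iff.2 hf)).trans ?_
  refine tsum_congr fun N => ?_
  rw [tsum_fintype]
  exact Finset.sum_coe_sort (Finset.HasAntidiagonal.antidiagonal N) f

/-- **Pfaff's transformation** of `₂F₁`, near the origin. The hypotheses `ha`, `he` make the radius
of validity explicit, so that it does not depend on the parameters individually. -/
theorem pfaff_transformation {a e c v : ℂ} {C C' : ℝ} (hc : ∀ j : ℕ, c + j ≠ 0)
    (ha : ∀ n, ‖pochhammerC a n‖ ≤ C * 2 ^ n * (n.factorial : ℝ))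
    (he : ∀ n, ‖pochhammerC e n‖ ≤ C' * 2 ^ n * ‖pochhammerC c n‖) (hv : ‖v‖ < 1 / 8) :
    ∑' N : ℕ, pochhammerC a N * pochhammerC (c - e) N / (pochhammerC c N * (N.factorial : ℂ)) *
        v ^ N =
      (1 - v) ^ (-a) * ∑' n : ℕ, pochhammerC a n / (n.factorial : ℂ) *
        (pochhammerC e n / pochhammerC c n) * (v / (v - 1)) ^ n := by
  have hfac : ∀ k : ℕ, (k.factorial : ℂ) ≠ 0 := fun k => by exact_mod_cast k.factorial_ne_zero
  have hpc : ∀ k, pochhammerC c k ≠ 0 := pochhammerC_ne_zero hc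
  have hv1 : 1 - v ≠ 0 := by
    intro h
    rw [← sub_eq_zero.1 h] at hv
    norm_num at hv
  have hC : 0 ≤ C := by
    have := (norm_nonneg _).trans (ha 0)
    simpa using this
  have hC' : 0 ≤ C' := by
    have := (norm_nonneg _).trans (he 0)
    simpa [pochhammerC_zero] using this
  set F : ℕ × ℕ → ℂ := fun p => pochhammerC a (p.1 + p.2) / ((p.1.factorial : ℂ) * p.2.factorial) *
    (pochhammerC e p.1 / pochhammerC c p.1) * (-1) ^ p.1 * v ^ (p.1 + p.2) with hF
  have hbound : ∀ p, ‖F p‖ ≤ C * C' * ((8 * ‖v‖) ^ p.1 * (8 * ‖v‖) ^ p.2) := by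
    rintro ⟨n, k⟩
    have hn : (0 : ℝ) < n.factorial := by exact_mod_cast n.factorial_pos
    have hk : (0 : ℝ) < k.factorial := by exact_mod_cast k.factorial_pos
    have h1 : ‖pochhammerC e n / pochhammerC c n‖ ≤ C' * 2 ^ (n + k) := by
      rw [norm_div, div_le_iff₀ (norm_pos_iff.2 (hpc n))]
      refine (he n).trans (mul_le_mul_of_nonneg_right ?_ (norm_nonneg _))
      exact mul_le_mul_of_nonneg_left (pow_le_pow_right₀ (by norm_num) (by omega)) hC'
    have h2 : ‖pochhammerC a (n + k) / ((n.factorial : ℂ) * k.factorial)‖ ≤ C * 4 ^ (n + k) := by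
      rw [norm_div, norm_mul, Complex.norm_natCast, Complex.norm_natCast,
        div_le_iff₀ (by positivity)]
      refine (ha _).trans ?_
      have h3 : ((n + k).factorial : ℝ) ≤ 2 ^ (n + k) * (n.factorial * k.factorial) := by
        have := Nat.add_choose_mul_factorial_mul_factorial n k
        have h4 : (n + k).choose k ≤ 2 ^ (n + k) := Nat.choose_le_two_pow _ _
        rw [← this, mul_assoc]
        push_cast
        refine mul_le_mul_of_nonneg_right ?_ (by positivity)
        exact_mod_cast h4
      calc C * 2 ^ (n + k) * ((n + k).factorial : ℝ)
          ≤ C * 2 ^ (n + k) * (2 ^ (n + k) * (n.factorial * k.factorial)) := by gcongr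
        _ = C * (2 * 2) ^ (n + k) * (n.factorial * k.factorial) := by rw [mul_pow]; ring
        _ = _ := by norm_num
    simp only [hF, norm_mul, norm_pow, norm_neg, norm_one, one_pow, mul_one]
    calc _ ≤ C * 4 ^ (n + k) * (C' * 2 ^ (n + k)) * ‖v‖ ^ (n + k) := by
            gcongr
      _ = C * C' * ((4 * 2) * ‖v‖) ^ (n + k) := by rw [mul_pow, mul_pow]; ring
      _ = _ := by rw [pow_add]; norm_num
  have hgeo : Summable fun n : ℕ => (8 * ‖v‖) ^ n :=
    summable_geometric_of_lt_one (by positivity) (by linarith)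
  have hsum : Summable F := Summable.of_norm_bounded
    ((hgeo.mul_of_nonneg hgeo (fun _ => by positivity) (fun _ => by positivity)).mul_left _) hbound
  have hleft : ∑' p, F p = ∑' N : ℕ, pochhammerC a N * pochhammerC (c - e) N /
      (pochhammerC c N * (N.factorial : ℂ)) * v ^ N := by
    rw [tsum_prod_eq_tsum_sum_antidiagonal hsum]
    refine tsum_congr fun N => ?_
    rw [← sum_choose_mul_pochhammerC, Finset.Nat.sum_antidiagonal_eq_sum_range_succ_mk,
      Finset.mul_sum, Finset.sum_div, Finset.sum_mul]
    refine Finset.sum_congr rfl fun n hn => ?_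
    obtain ⟨k, rfl⟩ := Nat.exists_eq_add_of_le (Nat.lt_succ_iff.1 (Finset.mem_range.1 hn))
    have hch : ((n + k).choose n : ℂ) * n.factorial * k.factorial = (n + k).factorial := by
      rw [Nat.choose_symm_add]
      exact_mod_cast Nat.add_choose_mul_factorial_mul_factorial n k
    have hpc2 := hpc (n + k)
    rw [pochhammerC_add] at hpc2
    have hpc3 := right_ne_zero_of_mul hpc2
    simp only [hF, Nat.add_sub_cancel_left]
    rw [← hch, pochhammerC_add c n k]
    have h1 := hfac n
    have h2 := hfac k
    have h3 := hpc n
    have h4 : ((n + k).choose n : ℂ) ≠ 0 := by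
      exact_mod_cast (Nat.choose_pos (Nat.le_add_right n k)).ne'
    field_simp
  rw [← hleft, hsum.tsum_prod, ← tsum_mul_left]
  refine tsum_congr fun n => ?_
  have hb := hasSum_one_sub_cpow_neg (a + n) (v := v) (by linarith)
  have hpow : (1 - v) ^ (-a) * (v / (v - 1)) ^ n = (-1) ^ n * v ^ n * (1 - v) ^ (-(a + n)) := by
    rw [show -(a + (n : ℂ)) = -a - n by ring, Complex.cpow_sub _ _ hv1, Complex.cpow_natCast,
      show v / (v - 1) = -1 * v / (1 - v) by rw [← neg_sub 1 v, div_neg]; ring, div_pow, mul_pow]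
    ring
  calc ∑' k, F (n, k) = ∑' k : ℕ, pochhammerC a n / (n.factorial : ℂ) *
        (pochhammerC e n / pochhammerC c n) * ((-1) ^ n * v ^ n) *
        (pochhammerC (a + n) k / (k.factorial : ℂ) * v ^ k) := by
        refine tsum_congr fun k => ?_
        simp only [hF, pochhammerC_add, pow_add]
        have h1 := hfac n
        have h2 := hfac k
        field_simp
    _ = _ := by
        rw [tsum_mul_left, hb.tsum_eq, mul_assoc, ← hpow]
        ring

/-! ### The continuation of the third Appell function -/

/-- The numerator of the coefficient of `u ^ m * w ^ n` in the expansion of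
`(1 - v) ^ a * F₃(α, a, β, γ - δ; γ; u, v)` in powers of `u` and `w = v / (v - 1)`. It does not
involve `γ`, as `δ` replaces the parameter `β' = γ - δ`. -/
noncomputable def appellNum (α β δ a : ℂ) (p : ℕ × ℕ) : ℂ :=
  pochhammerC α p.1 * pochhammerC β p.1 / (p.1.factorial : ℂ) *
    (pochhammerC a p.2 / (p.2.factorial : ℂ)) * pochhammerC (δ + p.1) p.2

/-- The coefficient of `u ^ m * w ^ n`; see `appellNum`. -/
noncomputable def appellCoeff (α β δ a γ : ℂ) (p : ℕ × ℕ) : ℂ :=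
  appellNum α β δ a p / pochhammerC γ (p.1 + p.2)

/-- The sum of the double series with coefficients `appellCoeff`. -/
noncomputable def appellBivariate (α β δ a γ : ℂ) (z : ℂ × ℂ) : ℂ :=
  ∑' p : ℕ × ℕ, appellCoeff α β δ a γ p * (z.1 ^ p.1 * z.2 ^ p.2)

/-- The coefficients grow subexponentially, so that the double series converges on the unit
polydisc. -/
theorem exists_norm_appellCoeff_le (α β δ a : ℂ) {γ : ℂ} (hγ : 0 < γ.re) {Q : ℝ} (hQ : 1 < Q) :
    ∃ C : ℝ, 0 < C ∧ ∀ p : ℕ × ℕ, ‖appellCoeff α β δ a γ p‖ ≤ C * (Q ^ p.1 * Q ^ p.2) := by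
  have hq : 1 < √Q := Real.lt_sqrt_of_sq_lt (by simpa using hQ)
  have hq0 : 0 < √Q := by linarith
  have hγ' := add_natCast_ne_zero_of_re_pos hγ
  have h1' : ∀ j : ℕ, (1 : ℂ) + j ≠ 0 := add_natCast_ne_zero_of_re_pos (by simp)
  obtain ⟨C₁, hC₁, h₁⟩ := exists_norm_pochhammerC_add_le hq0 hγ'
    (eventually_norm_add_natCast_le α γ hq)
  obtain ⟨C₂, hC₂, h₂⟩ := exists_norm_pochhammerC_add_le hq0 h1'
    (eventually_norm_add_natCast_le β 1 hq)
  obtain ⟨C₃, hC₃, h₃⟩ := exists_norm_pochhammerC_add_le hq0 h1'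
    (eventually_norm_add_natCast_le a 1 hq)
  obtain ⟨C₄, hC₄, h₄⟩ := exists_norm_pochhammerC_add_le hq0 hγ'
    (eventually_norm_add_natCast_le δ γ hq)
  refine ⟨C₁ * C₂ * C₃ * C₄, by positivity, ?_⟩
  rintro ⟨m, n⟩
  have b₁ := h₁ 0 m
  have b₂ := h₂ 0 m
  have b₃ := h₃ 0 n
  have b₄ := h₄ m n
  simp only [Nat.cast_zero, add_zero, pochhammerC_one, Complex.norm_natCast] at b₁ b₂ b₃
  have hm : (0 : ℝ) < m.factorial := by exact_mod_cast m.factorial_pos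
  have hn : (0 : ℝ) < n.factorial := by exact_mod_cast n.factorial_pos
  have hg : 0 < ‖pochhammerC γ m * pochhammerC (γ + m) n‖ := by
    rw [← pochhammerC_add]
    exact norm_pos_iff.2 (pochhammerC_ne_zero hγ' _)
  simp only [appellCoeff, appellNum, pochhammerC_add γ m n]
  rw [norm_div, div_le_iff₀ hg]
  simp only [norm_mul, norm_div, Complex.norm_natCast]
  have e : ∀ k : ℕ, Q ^ k = √Q ^ k * √Q ^ k := fun k => by
    rw [← mul_pow, Real.mul_self_sqrt (by linarith)]
  calc _ ≤ C₁ * √Q ^ m * ‖pochhammerC γ m‖ * (C₂ * √Q ^ m * m.factorial) / m.factorial *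
        (C₃ * √Q ^ n * n.factorial / n.factorial) *
        (C₄ * √Q ^ n * ‖pochhammerC (γ + m) n‖) := by gcongr
    _ = _ := by rw [e m, e n]; field_simp

theorem summable_norm_appellCoeff_mul (α β δ a : ℂ) {γ : ℂ} (hγ : 0 < γ.re) {r s : ℝ}
    (hr : 0 ≤ r) (hr1 : r < 1) (hs : 0 ≤ s) (hs1 : s < 1) :
    Summable fun p : ℕ × ℕ => ‖appellCoeff α β δ a γ p‖ * (r ^ p.1 * s ^ p.2) := by
  obtain ⟨Q, hQ1, hQ⟩ : ∃ Q : ℝ, 1 < Q ∧ Q * (max r s) < 1 := by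
    have h1 : max r s < 1 := max_lt hr1 hs1
    have h0 : 0 ≤ max r s := le_max_of_le_left hr
    refine ⟨2 / (1 + max r s), (one_lt_div (by linarith)).2 (by linarith), ?_⟩
    rw [div_mul_eq_mul_div, div_lt_one (by linarith)]
    linarith
  obtain ⟨C, hC, h⟩ := exists_norm_appellCoeff_le α β δ a hγ hQ1
  have hQr : Q * r < 1 := lt_of_le_of_lt (by gcongr; exact le_max_left _ _) hQ
  have hQs : Q * s < 1 := lt_of_le_of_lt (by gcongr; exact le_max_right _ _) hQ
  have hsum := ((summable_geometric_of_lt_one (by positivity) hQr).mul_of_nonneg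
    (summable_geometric_of_lt_one (by positivity) hQs) (fun _ => by positivity)
    (fun _ => by positivity)).mul_left C
  refine hsum.of_nonneg_of_le (fun p => by positivity) fun p => ?_
  calc _ ≤ C * (Q ^ p.1 * Q ^ p.2) * (r ^ p.1 * s ^ p.2) := by gcongr; exact h p
    _ = _ := by rw [mul_pow, mul_pow]; ring

theorem summable_appellCoeff_mul (α β δ a : ℂ) {γ : ℂ} (hγ : 0 < γ.re) {u w : ℂ}
    (hu : ‖u‖ < 1) (hw : ‖w‖ < 1) :
    Summable fun p : ℕ × ℕ => appellCoeff α β δ a γ p * (u ^ p.1 * w ^ p.2) := by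
  refine Summable.of_norm ?_
  simpa using summable_norm_appellCoeff_mul α β δ a hγ (norm_nonneg u) hu (norm_nonneg w) hw

/-- Termwise differentiation, with derivatives bounded by the series at a slightly larger radius. -/
theorem differentiableOn_appellBivariate (α β δ a : ℂ) {γ : ℂ} (hγ : 0 < γ.re) :
    DifferentiableOn ℂ (appellBivariate α β δ a γ) (Metric.ball 0 1 ×ˢ Metric.ball 0 1) := by
  rintro ⟨u₀, w₀⟩ ⟨hu₀, hw₀⟩
  rw [mem_ball_zero_iff] at hu₀ hw₀
  simp only at hu₀ hw₀
  obtain ⟨r, hr, hr1⟩ := exists_between (max_lt hu₀ hw₀)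
  have hr0 : 0 < r := lt_of_le_of_lt (le_max_of_le_left (norm_nonneg _)) hr
  obtain ⟨Q, hQ1, hQ⟩ : ∃ Q : ℝ, 1 < Q ∧ Q * r < 1 := by
    refine ⟨2 / (1 + r), (one_lt_div (by linarith)).2 (by linarith), ?_⟩
    rw [div_mul_eq_mul_div, div_lt_one (by linarith)]
    linarith
  have hpow : ∀ k : ℕ, (k : ℝ) * r ^ (k - 1) ≤ (r * (Q - 1))⁻¹ * (Q * r) ^ k := by
    intro k
    rcases k with _ | k
    · simp
      exact mul_nonneg (inv_nonneg.2 (by linarith)) (by positivity)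
    have h1 := one_add_mul_sub_le_pow (show -1 ≤ Q by linarith) (k + 1)
    rw [inv_mul_eq_div, le_div_iff₀ (mul_pos hr0 (by linarith)), mul_pow]
    calc ((k + 1 : ℕ) : ℝ) * r ^ (k + 1 - 1) * (r * (Q - 1))
        = ((k + 1 : ℕ) * (Q - 1)) * r ^ (k + 1) := by simp; ring
      _ ≤ _ := mul_le_mul_of_nonneg_right (by linarith) (by positivity)
  set s : Set (ℂ × ℂ) := Metric.ball 0 r ×ˢ Metric.ball 0 r with hs
  have hso : IsOpen s := Metric.isOpen_ball.prod Metric.isOpen_ball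
  have hsc : IsPreconnected s :=
    ((convex_ball (0 : ℂ) r).prod (convex_ball (0 : ℂ) r)).isPreconnected
  have hmem : (u₀, w₀) ∈ s := by
    rw [max_lt_iff] at hr
    simpa [hs] using hr
  have hf : ∀ (p : ℕ × ℕ) (z : ℂ × ℂ), z ∈ s → HasFDerivAt
      (fun z : ℂ × ℂ => appellCoeff α β δ a γ p * (z.1 ^ p.1 * z.2 ^ p.2))
      (appellCoeff α β δ a γ p • (z.1 ^ p.1 • (((p.2 : ℂ) * z.2 ^ (p.2 - 1)) •
        ContinuousLinearMap.snd ℂ ℂ ℂ) + z.2 ^ p.2 • (((p.1 : ℂ) * z.1 ^ (p.1 - 1)) •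
        ContinuousLinearMap.fst ℂ ℂ ℂ))) z := by
    intro p z _
    have h1 : HasFDerivAt (fun z : ℂ × ℂ => z.1 ^ p.1)
        (((p.1 : ℂ) * z.1 ^ (p.1 - 1)) • ContinuousLinearMap.fst ℂ ℂ ℂ) z := by
      exact (hasDerivAt_pow p.1 z.1).comp_hasFDerivAt z hasFDerivAt_fst
    have h2 : HasFDerivAt (fun z : ℂ × ℂ => z.2 ^ p.2)
        (((p.2 : ℂ) * z.2 ^ (p.2 - 1)) • ContinuousLinearMap.snd ℂ ℂ ℂ) z := by
      exact (hasDerivAt_pow p.2 z.2).comp_hasFDerivAt z hasFDerivAt_snd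
    exact (h1.mul h2).const_mul _
  have hsum := (summable_norm_appellCoeff_mul α β δ a hγ (by positivity) hQ
    (by positivity) hQ).mul_left (2 * (r * (Q - 1))⁻¹)
  refine (hasFDerivAt_tsum_of_isPreconnected hsum hso hsc hf ?_ hmem
    (summable_appellCoeff_mul α β δ a hγ hu₀ hw₀) hmem).differentiableAt.differentiableWithinAt
  rintro p z ⟨hz1, hz2⟩
  rw [mem_ball_zero_iff] at hz1 hz2
  have hle : ∀ (x : ℂ) (k : ℕ), ‖x‖ < r → ‖x‖ ^ k ≤ (Q * r) ^ k := fun x k hx =>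
    pow_le_pow_left₀ (norm_nonneg _) (by nlinarith) k
  have hd : ∀ (x : ℂ) (k : ℕ), ‖x‖ < r →
      (k : ℝ) * ‖x‖ ^ (k - 1) ≤ (r * (Q - 1))⁻¹ * (Q * r) ^ k := fun x k hx =>
    (mul_le_mul_of_nonneg_left (pow_le_pow_left₀ (norm_nonneg _) hx.le _)
      (Nat.cast_nonneg _)).trans (hpow k)
  have hK : 0 ≤ (r * (Q - 1))⁻¹ := inv_nonneg.2 (mul_nonneg hr0.le (by linarith))
  rw [norm_smul]
  calc _ ≤ ‖appellCoeff α β δ a γ p‖ * ((Q * r) ^ p.1 * ((r * (Q - 1))⁻¹ * (Q * r) ^ p.2) +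
        (Q * r) ^ p.2 * ((r * (Q - 1))⁻¹ * (Q * r) ^ p.1)) := by
        gcongr
        refine (norm_add_le _ _).trans (add_le_add ?_ ?_)
        · rw [norm_smul, norm_smul, norm_mul, norm_pow, norm_pow, Complex.norm_natCast]
          refine mul_le_mul (hle _ _ hz1) ?_ (by positivity) (by positivity)
          exact (mul_le_of_le_one_right (by positivity)
            (ContinuousLinearMap.norm_snd_le ℂ ℂ ℂ)).trans (hd _ _ hz2)
        · rw [norm_smul, norm_smul, norm_mul, norm_pow, norm_pow, Complex.norm_natCast]
          refine mul_le_mul (hle _ _ hz2) ?_ (by positivity) (by positivity)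
          exact (mul_le_of_le_one_right (by positivity)
            (ContinuousLinearMap.norm_fst_le ℂ ℂ ℂ)).trans (hd _ _ hz1)
    _ = _ := by ring

theorem norm_div_sub_one_lt_one {v : ℂ} (hv : v.re < 1 / 2) : ‖v / (v - 1)‖ < 1 := by
  have h1 : v - 1 ≠ 0 := by
    intro h
    rw [sub_eq_zero.1 h] at hv
    norm_num at hv
  rw [norm_div, div_lt_one (norm_pos_iff.2 h1), ← sq_lt_sq₀ (norm_nonneg _) (norm_nonneg _),
    Complex.sq_norm, Complex.sq_norm, Complex.normSq_apply, Complex.normSq_apply]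
  simp
  nlinarith

/-- Near the origin the double series of `F₃` is, for each fixed power of `u`, a `₂F₁` series in
`v`; Pfaff's transformation turns it into a series in `v / (v - 1)`. -/
theorem appellF3Series_eq (α a β b' : ℂ) {γ u v : ℂ} (hγ : 0 < γ.re) (hu : ‖u‖ < 1)
    (hv : ‖v‖ < 1 / 8) :
    appellF3Series α a β b' γ u v =
      (1 - v) ^ (-a) * appellBivariate α β (γ - b') a γ (u, v / (v - 1)) := by
  have hfac : ∀ k : ℕ, (k.factorial : ℂ) ≠ 0 := fun k => by exact_mod_cast k.factorial_ne_zero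
  have hγ' := add_natCast_ne_zero_of_re_pos hγ
  have h1' : ∀ j : ℕ, (1 : ℂ) + j ≠ 0 := add_natCast_ne_zero_of_re_pos (by simp)
  have hγm : ∀ m j : ℕ, γ + m + j ≠ 0 := fun m j => by
    rw [add_assoc, ← Nat.cast_add]; exact hγ' _
  have hv1 : v.re < 1 / 2 := by
    have := Complex.re_le_norm v
    linarith
  have hw := norm_div_sub_one_lt_one hv1
  obtain ⟨Ca, hCa, ha⟩ := exists_norm_pochhammerC_add_le two_pos h1'
    (eventually_norm_add_natCast_le a 1 one_lt_two)
  obtain ⟨Ce, hCe, he⟩ := exists_norm_pochhammerC_add_le two_pos hγ'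
    (eventually_norm_add_natCast_le (γ - b') γ one_lt_two)
  have hsum : Summable fun p : ℕ × ℕ =>
      pochhammerC α p.1 * pochhammerC a p.2 * pochhammerC β p.1 * pochhammerC b' p.2 /
      (pochhammerC γ (p.1 + p.2) * (p.1.factorial : ℂ) * (p.2.factorial : ℂ)) *
      u ^ p.1 * v ^ p.2 := by
    have hg0 : 0 < (γ.re : ℂ).re := by simpa using hγ
    have hg' := add_natCast_ne_zero_of_re_pos hg0
    obtain ⟨Cb, hCb, hb⟩ := exists_norm_pochhammerC_add_le two_pos hg'
      (eventually_norm_add_natCast_le b' (γ.re : ℂ) one_lt_two)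
    have hinj : Function.Injective fun m : ℕ => (m, 0) := fun m n h => (Prod.mk.inj h).1
    have hm := (summable_norm_appellCoeff_mul α β 0 0 hγ (norm_nonneg u) hu le_rfl
      one_pos).comp_injective hinj
    have hn : Summable fun n : ℕ => Ca * Cb * (4 * ‖v‖) ^ n :=
      (summable_geometric_of_lt_one (by positivity) (by linarith)).mul_left _
    refine Summable.of_norm_bounded (hm.mul_of_nonneg hn (fun m => mul_nonneg (norm_nonneg _)
      (by positivity)) (fun _ => by positivity)) ?_
    rintro ⟨m, n⟩
    have ha' := ha 0 n
    have hb' := hb 0 n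
    simp only [Nat.cast_zero, add_zero, pochhammerC_one, Complex.norm_natCast] at ha' hb'
    have hle : ‖pochhammerC (γ.re : ℂ) n‖ ≤ ‖pochhammerC (γ + m) n‖ :=
      norm_pochhammerC_ofReal_le hγ.le (by simp) n
    have hpos : 0 < ‖pochhammerC (γ.re : ℂ) n‖ := norm_pos_iff.2 (pochhammerC_ne_zero hg' n)
    have hfn : (0 : ℝ) < n.factorial := by exact_mod_cast n.factorial_pos
    have h4 : ‖pochhammerC a n / (n.factorial : ℂ)‖ ≤ Ca * 2 ^ n := by
      rw [norm_div, Complex.norm_natCast, div_le_iff₀ hfn]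
      exact ha'
    have h5 : ‖pochhammerC b' n / pochhammerC (γ + m) n‖ ≤ Cb * 2 ^ n := by
      rw [norm_div, div_le_iff₀ (hpos.trans_le hle)]
      exact hb'.trans (mul_le_mul_of_nonneg_left hle (by positivity))
    have e : pochhammerC α m * pochhammerC a n * pochhammerC β m * pochhammerC b' n /
        (pochhammerC γ (m + n) * (m.factorial : ℂ) * (n.factorial : ℂ)) * u ^ m * v ^ n =
        appellCoeff α β 0 0 γ (m, 0) * u ^ m * ((pochhammerC a n / (n.factorial : ℂ)) *
          (pochhammerC b' n / pochhammerC (γ + m) n) * v ^ n) := by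
      have h1 := hfac n
      have h2 := hfac m
      have h3 := pochhammerC_ne_zero (hγm m) n
      have h6 := pochhammerC_ne_zero hγ' m
      simp only [appellCoeff, appellNum, pochhammerC_add γ m n, pochhammerC_zero, add_zero,
        Nat.factorial_zero, Nat.cast_one, div_one, mul_one]
      field_simp
    rw [e, norm_mul]
    refine mul_le_mul (by simp) ?_ (norm_nonneg _) (mul_nonneg (norm_nonneg _) (by positivity))
    rw [norm_mul, norm_mul, norm_pow]
    calc _ ≤ Ca * 2 ^ n * (Cb * 2 ^ n) * ‖v‖ ^ n := by gcongr
      _ = Ca * Cb * ((2 * 2) * ‖v‖) ^ n := by rw [mul_pow, mul_pow]; ring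
      _ = _ := by norm_num
  rw [appellF3Series, hsum.tsum_prod, appellBivariate,
    (summable_appellCoeff_mul α β (γ - b') a hγ hu hw).tsum_prod, ← tsum_mul_left]
  refine tsum_congr fun m => ?_
  have hp := pfaff_transformation (a := a) (e := γ - b' + m) (c := γ + m) (v := v) (C := Ca)
    (C' := Ce) (hγm m) (fun n => by simpa [pochhammerC_one] using ha 0 n) (fun n => he m n) hv
  rw [show γ + m - (γ - b' + m) = b' by ring] at hp
  have hg := pochhammerC_ne_zero hγ' m
  have hg2 := fun n => pochhammerC_ne_zero (hγm m) n
  calc _ = pochhammerC α m * pochhammerC β m / (pochhammerC γ m * m.factorial) * u ^ m *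
        ∑' N : ℕ, pochhammerC a N * pochhammerC b' N /
          (pochhammerC (γ + m) N * (N.factorial : ℂ)) * v ^ N := by
        rw [← tsum_mul_left]
        refine tsum_congr fun n => ?_
        have h1 := hfac n
        have h2 := hfac m
        have h3 := hg2 n
        simp only [pochhammerC_add γ m n]
        field_simp
    _ = _ := by
        rw [hp, mul_left_comm, ← tsum_mul_left]
        congr 1
        refine tsum_congr fun n => ?_
        have h1 := hfac n
        have h2 := hfac m
        have h3 := hg2 n
        simp only [appellCoeff, appellNum, pochhammerC_add γ m n]
        field_simp

/-- The continuation of `F₃` to `{|u| < 1, Re v < 1/2}` by Pfaff's transformation. -/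
theorem isAppellF3_appellBivariate (α a β b' : ℂ) {γ : ℂ} (hγ : 0 < γ.re) :
    IsAppellF3 α a β b' γ
      (fun z => (1 - z.2) ^ (-a) * appellBivariate α β (γ - b') a γ (z.1, z.2 / (z.2 - 1))) := by
  constructor
  · have h1 : ∀ z ∈ appellF3Domain, z.2 - 1 ≠ 0 := by
      rintro z ⟨-, hz⟩ h
      have hz' : z.2.re < 1 / 2 := hz
      rw [sub_eq_zero.1 h] at hz'
      norm_num at hz'
    refine DifferentiableOn.mul ?_ ?_
    · refine DifferentiableOn.cpow (by fun_prop) (by fun_prop) ?_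
      rintro z ⟨-, hz⟩
      refine Or.inl ?_
      have : z.2.re < 1 / 2 := hz
      simp
      linarith
    · refine (differentiableOn_appellBivariate α β (γ - b') a hγ).comp
        (DifferentiableOn.prodMk (by fun_prop) ?_) ?_
      · intro z hz
        have h2 : DifferentiableAt ℂ (fun z : ℂ × ℂ => z.2) z := differentiableAt_snd
        have h3 := h2.fun_mul ((h2.sub_const 1).fun_inv (h1 z hz))
        simpa only [div_eq_mul_inv] using h3.differentiableWithinAt
      rintro z ⟨hz1, hz2⟩
      exact ⟨hz1, mem_ball_zero_iff.2 (norm_div_sub_one_lt_one hz2)⟩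
  · filter_upwards [(Metric.isOpen_ball.prod Metric.isOpen_ball).mem_nhds
      (show (0 : ℂ × ℂ) ∈ Metric.ball (0 : ℂ) 1 ×ˢ Metric.ball (0 : ℂ) (1 / 8) by simp)] with z hz
    exact (appellF3Series_eq α a β b' hγ (by simpa using hz.1) (by simpa using hz.2)).symm

/-- At the arguments in the kernel of the fractional integral the two variables `u` and
`v / (v - 1)` coincide. -/
theorem appellF3_kernel (α a β b' : ℂ) {γ : ℂ} (hγ : 0 < γ.re) {x t : ℝ} (ht : 0 < t)
    (htx : t < x) :
    appellF3 α a β b' γ (1 - (t : ℂ) / (x : ℂ)) (1 - (x : ℂ) / (t : ℂ)) =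
      ((x / t : ℝ) : ℂ) ^ (-a) * appellBivariate α β (γ - b') a γ
        (((1 - t / x : ℝ) : ℂ), ((1 - t / x : ℝ) : ℂ)) := by
  have hx : 0 < x := ht.trans htx
  have hF := isAppellF3_appellBivariate α a β b' hγ
  have hE : IsAppellF3 α a β b' γ (Classical.epsilon (IsAppellF3 α a β b' γ)) :=
    Classical.epsilon_spec ⟨_, hF⟩
  have hmem : ((1 - (t : ℂ) / (x : ℂ)), (1 - (x : ℂ) / (t : ℂ))) ∈ appellF3Domain := by
    constructor
    · have h0 : 0 < t / x := by positivity
      have h1 : t / x < 1 := (div_lt_one hx).2 htx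
      rw [mem_ball_zero_iff]
      rw [← Complex.ofReal_div, ← Complex.ofReal_one, ← Complex.ofReal_sub, Complex.norm_real,
        Real.norm_of_nonneg (by linarith)]
      linarith
    · have h1 : 1 < x / t := (one_lt_div ht).2 htx
      change (1 - (x : ℂ) / (t : ℂ)).re < 1 / 2
      rw [← Complex.ofReal_div, Complex.sub_re, Complex.one_re, Complex.ofReal_re]
      linarith
  rw [appellF3, hE.eqOn hF hmem]
  have hx' : (x : ℂ) ≠ 0 := by exact_mod_cast hx.ne'
  have ht' : (t : ℂ) ≠ 0 := by exact_mod_cast ht.ne'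
  have e : (1 - (x : ℂ) / t) / (1 - (x : ℂ) / t - 1) = 1 - (t : ℂ) / x := by
    rw [show 1 - (x : ℂ) / t - 1 = -(x / t) by ring]
    field_simp
    ring
  simp only [e]
  push_cast
  ring_nf

/-! ### Absolute convergence of the double series -/

theorem gaussTerm_ofReal_eq_norm {A d τ : ℝ} (hA : 0 ≤ A) (hd : 0 ≤ d) (hτ : 0 < τ) (n : ℕ) :
    gaussTerm A d τ n = (‖gaussTerm A d τ n‖ : ℂ) := by
  have h : (Complex.Gamma ((τ : ℂ) + n))⁻¹ = (‖(Complex.Gamma ((τ : ℂ) + n))⁻¹‖ : ℂ) := by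
    rw [← Complex.ofReal_natCast, ← Complex.ofReal_add, Complex.Gamma_ofReal,
      ← Complex.ofReal_inv, Complex.norm_real, Real.norm_of_nonneg]
    exact inv_nonneg.2 (Real.Gamma_pos_of_pos (by positivity)).le
  rw [gaussTerm, pochhammerC_ofReal_eq_norm hA, pochhammerC_ofReal_eq_norm hd, h]
  simp

theorem tsum_norm_gaussTerm {A d τ : ℝ} (hA : 0 ≤ A) (hd : 0 ≤ d) (hτ : 0 < τ) (h : A + d < τ) :
    ∑' n, ‖gaussTerm A d τ n‖ = ‖Complex.Gamma ((τ : ℂ) - A - d)‖ *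
      (‖(Complex.Gamma ((τ : ℂ) - A))⁻¹‖ * ‖(Complex.Gamma ((τ : ℂ) - d))⁻¹‖) := by
  have h1 := tsum_gaussTerm (a := A) (b := d) (c := τ) (by simpa using h)
  rw [← norm_mul, ← norm_mul, ← h1]
  rw [tsum_congr (gaussTerm_ofReal_eq_norm hA hd hτ), ← Complex.ofReal_tsum, Complex.norm_real,
    Real.norm_of_nonneg (tsum_nonneg fun _ => norm_nonneg _)]

theorem eventually_norm_pochhammerC_add_le (z : ℂ) {d : ℝ} (hd : z.re < d) :
    ∀ᶠ m : ℕ in Filter.atTop, ∀ n : ℕ,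
      ‖pochhammerC (z + m) n‖ ≤ ‖pochhammerC ((d + m : ℝ) : ℂ) n‖ := by
  obtain ⟨m₀, h⟩ := Filter.eventually_atTop.1 (eventually_norm_add_natCast_le_add z hd)
  filter_upwards [Filter.eventually_ge_atTop m₀] with m hm n
  rw [pochhammerC_eq_prod, pochhammerC_eq_prod, norm_prod, norm_prod]
  refine Finset.prod_le_prod (fun _ _ => norm_nonneg _) fun j _ => ?_
  have := h (m + j) (by omega)
  push_cast at this
  rw [add_assoc]
  refine this.trans ((le_abs_self _).trans ?_)
  rw [← Real.norm_eq_abs, ← Complex.norm_real]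
  push_cast
  rw [add_assoc]

/-- The sum over `n` is controlled, uniformly in `m`, by comparison with a Gauss series with
positive terms, whose value is known. Here `0 < a.re` enters: it provides a positive majorant
of `(a)_n` without spoiling the exponents. -/
theorem summable_norm_appellNum_mul {α β δ a : ℂ} {τ : ℝ} (ha : 0 < a.re)
    (h₁ : a.re + δ.re < τ) (h₂ : α.re + β.re + a.re < τ) :
    Summable fun p : ℕ × ℕ =>
      ‖appellNum α β δ a p‖ * ‖(Complex.Gamma ((τ : ℂ) + (p.1 + p.2 : ℕ)))⁻¹‖ := by
  have hterm : ∀ m n : ℕ, ‖appellNum α β δ a (m, n)‖ *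
      ‖(Complex.Gamma ((τ : ℂ) + (m + n : ℕ)))⁻¹‖ =
      ‖pochhammerC α m * pochhammerC β m / (m.factorial : ℂ)‖ *
        ‖gaussTerm a (δ + m) (τ + m) n‖ := by
    intro m n
    rw [← norm_mul, ← norm_mul, appellNum, gaussTerm]
    push_cast
    rw [add_assoc (τ : ℂ)]
    congr 1
    ring
  obtain ⟨ε, hε, hε₁, hε₂⟩ : ∃ ε : ℝ, 0 < ε ∧ a.re + δ.re + 2 * ε < τ ∧
      α.re + β.re + a.re + ε < τ := by
    refine ⟨min (τ - a.re - δ.re) (τ - α.re - β.re - a.re) / 3, ?_, ?_, ?_⟩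
    · have := lt_min (show 0 < τ - a.re - δ.re by linarith)
        (show 0 < τ - α.re - β.re - a.re by linarith)
      linarith
    · have := min_le_left (τ - a.re - δ.re) (τ - α.re - β.re - a.re)
      linarith
    · have := min_le_right (τ - a.re - δ.re) (τ - α.re - β.re - a.re)
      linarith
  set A : ℝ := a.re + ε with hA
  set d : ℝ := δ.re + ε with hd
  have hA0 : 0 < A := by linarith
  obtain ⟨C, hC, hCa⟩ := exists_norm_pochhammerC_add_le (z := a) (w := (A : ℂ)) one_pos
    (add_natCast_ne_zero_of_re_pos (by simpa using hA0)) (by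
      filter_upwards [eventually_norm_add_natCast_le_add a (show a.re < A by linarith)] with j hj
      rw [one_mul]
      refine hj.trans ((le_abs_self _).trans ?_)
      rw [← Real.norm_eq_abs, ← Complex.norm_real]
      push_cast
      rfl)
  have hrow : ∀ m : ℕ, Summable fun n => ‖gaussTerm a (δ + m) (τ + m) n‖ := fun m =>
    summable_norm_gaussTerm (by simp; linarith)
  rw [summable_prod_of_nonneg (fun p => by positivity)]
  refine ⟨fun m => ?_, ?_⟩
  · simp only [hterm]
    exact (hrow m).mul_left _
  · simp only [hterm, tsum_mul_left]
    have hg := (summable_norm_gaussTerm (a := α) (b := β) (c := ((τ - A : ℝ) : ℂ))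
      (by rw [Complex.ofReal_re]; linarith)).mul_left (C * (‖Complex.Gamma ((τ : ℂ) - A - d)‖ *
        ‖(Complex.Gamma ((τ : ℂ) - d))⁻¹‖))
    refine Summable.of_norm_bounded_eventually_nat hg ?_
    filter_upwards [eventually_norm_pochhammerC_add_le δ (show δ.re < d by linarith),
      (tendsto_natCast_atTop_atTop (R := ℝ)).eventually_gt_atTop (max (-d) (-τ))] with m hm hm'
    rw [max_lt_iff] at hm'
    have hdm : 0 ≤ d + m := by linarith
    have hτm : 0 < τ + m := by linarith
    have hle : ∀ n, ‖gaussTerm a (δ + m) (τ + m) n‖ ≤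
        C * ‖gaussTerm (A : ℂ) ((d + m : ℝ) : ℂ) ((τ + m : ℝ) : ℂ) n‖ := by
      intro n
      have h1 := hCa 0 n
      simp only [Nat.cast_zero, add_zero, one_pow, mul_one] at h1
      simp only [gaussTerm, norm_mul, norm_div]
      calc _ ≤ C * ‖pochhammerC (A : ℂ) n‖ * ‖pochhammerC ((d + m : ℝ) : ℂ) n‖ /
              ‖(n.factorial : ℂ)‖ * ‖(Complex.Gamma ((τ : ℂ) + m + n))⁻¹‖ := by
            gcongr
            exact hm n
        _ = _ := by push_cast; ring
    have hmaj := (summable_norm_gaussTerm (a := (A : ℂ)) (b := ((d + m : ℝ) : ℂ))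
      (c := ((τ + m : ℝ) : ℂ)) (by
        rw [Complex.ofReal_re, Complex.ofReal_re, Complex.ofReal_re]; linarith)).mul_left C
    have hts := Summable.tsum_le_tsum hle (hrow m) hmaj
    rw [tsum_mul_left, tsum_norm_gaussTerm hA0.le hdm hτm (by linarith)] at hts
    rw [Real.norm_of_nonneg (mul_nonneg (norm_nonneg _) (tsum_nonneg fun _ => norm_nonneg _))]
    refine (mul_le_mul_of_nonneg_left hts (norm_nonneg _)).trans (le_of_eq ?_)
    rw [gaussTerm, norm_mul]
    push_cast
    rw [show (τ : ℂ) + m - A - (d + m) = τ - A - d by ring,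
      show (τ : ℂ) + m - (d + m) = τ - d by ring, show (τ : ℂ) + m - A = τ - A + m by ring]
    ring

/-! ### The diagonal of the double series and its growth at `1` -/

/-- The value of the double series on the diagonal `u = w`, the case needed for the kernel of the
fractional integral. -/
noncomputable def appellDiag (α β δ a γ u : ℂ) : ℂ := appellBivariate α β δ a γ (u, u)

theorem appellDiag_eq_tsum (α β δ a γ u : ℂ) :
    appellDiag α β δ a γ u = ∑' p : ℕ × ℕ, appellCoeff α β δ a γ p * u ^ (p.1 + p.2) := by
  simp only [appellDiag, appellBivariate, pow_add]

theorem summable_appellCoeff_mul_pow (α β δ a : ℂ) {γ : ℂ} (hγ : 0 < γ.re) {u : ℂ}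
    (hu : ‖u‖ < 1) : Summable fun p : ℕ × ℕ => appellCoeff α β δ a γ p * u ^ (p.1 + p.2) := by
  simpa only [pow_add] using summable_appellCoeff_mul α β δ a hγ hu hu

theorem differentiableOn_appellDiag (α β δ a : ℂ) {γ : ℂ} (hγ : 0 < γ.re) :
    DifferentiableOn ℂ (appellDiag α β δ a γ) (Metric.ball 0 1) :=
  (differentiableOn_appellBivariate α β δ a hγ).comp
    (f := fun u : ℂ => (u, u)) (by fun_prop) fun _ hu => ⟨hu, hu⟩

/-- `h w = O(t ^ (-σ))` for `w` in the disc of radius `κ t` about `1 - t`, for each `κ < 1`. These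
discs fill a nontangential approach region at `1`; allowing complex `w` makes the condition stable
under `(1 - w) d/dw`. -/
def NontangentialGrowth (σ : ℝ) (h : ℂ → ℂ) : Prop :=
  ∀ κ : ℝ, 0 < κ → κ < 1 → ∃ C : ℝ, ∀ t : ℝ, 0 < t → t ≤ 1 → ∀ w : ℂ,
    ‖w - ((1 - t : ℝ) : ℂ)‖ ≤ κ * t → ‖h w‖ ≤ C * t ^ (-σ)

theorem norm_le_of_norm_sub_le {κ t : ℝ} (ht : t ≤ 1) {w : ℂ}
    (hw : ‖w - ((1 - t : ℝ) : ℂ)‖ ≤ κ * t) : ‖w‖ ≤ 1 - (1 - κ) * t := by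
  have h := norm_sub_norm_le w ((1 - t : ℝ) : ℂ)
  rw [Complex.norm_real, Real.norm_of_nonneg (by linarith)] at h
  linarith

/-- `r ^ k (1 - r) ^ σ / σ` is at most the Beta integral `B(σ, k + 1)`, as is seen by restricting
the latter to `[0, 1 - r]`. -/
theorem pow_mul_one_sub_rpow_le {r σ : ℝ} (hr : 0 ≤ r) (hr1 : r < 1) (hσ : 0 < σ) (k : ℕ) :
    r ^ k * (1 - r) ^ σ ≤ σ * ‖Complex.betaIntegral σ (k + 1)‖ := by
  have hint : ∀ a b : ℝ, IntervalIntegrable (fun t : ℝ => t ^ (σ - 1) * (1 - t) ^ k)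
      MeasureTheory.volume a b := fun a b =>
    (intervalIntegral.intervalIntegrable_rpow' (by linarith)).mul_continuousOn (by fun_prop)
  have hbeta : Complex.betaIntegral σ (k + 1) =
      ((∫ t in (0 : ℝ)..1, t ^ (σ - 1) * (1 - t) ^ k : ℝ) : ℂ) := by
    rw [Complex.betaIntegral, ← intervalIntegral.integral_ofReal]
    refine intervalIntegral.integral_congr fun t ht => ?_
    rw [Set.uIcc_of_le zero_le_one] at ht
    simp only [add_sub_cancel_right]
    rw [Complex.cpow_natCast]
    push_cast
    rw [Complex.ofReal_cpow ht.1]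
    push_cast
    rfl
  have h1 : ∫ t in (0 : ℝ)..(1 - r), t ^ (σ - 1) * r ^ k = (1 - r) ^ σ / σ * r ^ k := by
    rw [intervalIntegral.integral_mul_const, integral_rpow (Or.inl (by linarith))]
    simp [Real.zero_rpow hσ.ne']
  have h2 : ∫ t in (0 : ℝ)..(1 - r), t ^ (σ - 1) * r ^ k ≤
      ∫ t in (0 : ℝ)..(1 - r), t ^ (σ - 1) * (1 - t) ^ k := by
    refine intervalIntegral.integral_mono_on (by linarith)
      ((intervalIntegral.intervalIntegrable_rpow' (by linarith)).mul_const _) (hint _ _) ?_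
    intro t ht
    exact mul_le_mul_of_nonneg_left (pow_le_pow_left₀ hr (by linarith [ht.2]) k)
      (Real.rpow_nonneg ht.1 _)
  have h3 : ∫ t in (0 : ℝ)..(1 - r), t ^ (σ - 1) * (1 - t) ^ k ≤
      ∫ t in (0 : ℝ)..1, t ^ (σ - 1) * (1 - t) ^ k := by
    rw [← intervalIntegral.integral_add_adjacent_intervals (hint 0 (1 - r)) (hint (1 - r) 1)]
    refine le_add_of_nonneg_right (intervalIntegral.integral_nonneg (by linarith) fun t ht => ?_)
    exact mul_nonneg (Real.rpow_nonneg (by linarith [ht.1]) _)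
      (pow_nonneg (by linarith [ht.2]) _)
  rw [hbeta, Complex.norm_real]
  have h4 := (h1.symm.le.trans (h2.trans h3)).trans (Real.le_norm_self _)
  have h5 := mul_le_mul_of_nonneg_left h4 hσ.le
  refine le_trans (le_of_eq ?_) h5
  field_simp

theorem norm_appellCoeff_le {α β δ a γ : ℂ} (hγ : 0 < γ.re) (p : ℕ × ℕ) :
    ‖appellCoeff α β δ a γ p‖ * ‖pochhammerC (γ.re : ℂ) (p.1 + p.2)‖ ≤
      ‖appellNum α β δ a p‖ := by
  have hpos : 0 < ‖pochhammerC γ (p.1 + p.2)‖ :=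
    norm_pos_iff.2 (pochhammerC_ne_zero (add_natCast_ne_zero_of_re_pos hγ) _)
  rw [appellCoeff, norm_div, div_mul_eq_mul_div, div_le_iff₀ hpos]
  exact mul_le_mul_of_nonneg_left (norm_pochhammerC_ofReal_le hγ.le le_rfl _) (norm_nonneg _)

/-- A comparison of Beta integrals, `B(σ, k + 1) = O(B(σ, g + k))`, in terms of Pochhammer
symbols. It holds factor by factor because `1 ≤ g`. -/
theorem pochhammerC_ratio_le {g σ : ℝ} (hg : 1 ≤ g) (hσ : 0 < σ) (k : ℕ) :
    (k.factorial : ℝ) * ‖pochhammerC ((g + σ : ℝ) : ℂ) k‖ ≤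
      ‖pochhammerC (g : ℂ) k‖ * ‖pochhammerC ((σ + 1 : ℝ) : ℂ) k‖ := by
  rw [← Complex.norm_natCast, ← pochhammerC_one, ← norm_mul, ← norm_mul,
    pochhammerC_eq_prod, pochhammerC_eq_prod, pochhammerC_eq_prod, pochhammerC_eq_prod,
    ← Finset.prod_mul_distrib, ← Finset.prod_mul_distrib, norm_prod, norm_prod]
  refine Finset.prod_le_prod (fun _ _ => norm_nonneg _) fun j _ => ?_
  have hj : (0 : ℝ) ≤ j := Nat.cast_nonneg _
  have e1 : (1 + (j : ℂ)) * (((g + σ : ℝ) : ℂ) + j) = (((1 + j) * (g + σ + j) : ℝ) : ℂ) := by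
    push_cast; ring
  have e2 : ((g : ℂ) + j) * (((σ + 1 : ℝ) : ℂ) + j) = (((g + j) * (σ + 1 + j) : ℝ) : ℂ) := by
    push_cast; ring
  rw [e1, e2, Complex.norm_real, Complex.norm_real, Real.norm_of_nonneg (by positivity),
    Real.norm_of_nonneg (by positivity)]
  nlinarith

/-- Each power `r ^ k` is at most a constant times `B(σ, γ.re + k) (1 - r) ^ (-σ)`, and the double
series with the powers replaced by these Beta integrals converges absolutely. -/
theorem nontangentialGrowth_appellDiag_of_re_pos {α β δ a γ : ℂ} {σ : ℝ} (ha : 0 < a.re)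
    (hγ : 1 ≤ γ.re) (hσ : 0 < σ) (h₁ : a.re + δ.re < γ.re + σ)
    (h₂ : α.re + β.re + a.re < γ.re + σ) :
    NontangentialGrowth σ (appellDiag α β δ a γ) := by
  have hγ0 : 0 < γ.re := by linarith
  have hsum := summable_norm_appellNum_mul ha h₁ h₂
  set K : ℝ := σ * ‖Complex.Gamma (σ : ℂ)‖ * ‖(Complex.Gamma ((σ + 1 : ℝ) : ℂ))⁻¹‖ *
    ‖Complex.Gamma ((γ.re + σ : ℝ) : ℂ)‖ with hK
  have hpk : ∀ {z : ℝ}, 0 < z → ∀ k, 0 < ‖pochhammerC (z : ℂ) k‖ := fun hz k =>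
    norm_pos_iff.2 (pochhammerC_ne_zero (add_natCast_ne_zero_of_re_pos (by simpa using hz)) k)
  have hpow : ∀ (r : ℝ) (k : ℕ), 0 ≤ r → r < 1 → r ^ k ≤ K * (1 - r) ^ (-σ) *
      (‖pochhammerC (γ.re : ℂ) k‖ * ‖(Complex.Gamma (((γ.re + σ : ℝ) : ℂ) + k))⁻¹‖) := by
    intro r k hr hr1
    have hb := pow_mul_one_sub_rpow_le hr hr1 hσ k
    have hσ1 : 0 < ((σ + 1 : ℝ) : ℂ).re := by rw [Complex.ofReal_re]; linarith
    have hgσ : 0 < ((γ.re + σ : ℝ) : ℂ).re := by rw [Complex.ofReal_re]; linarith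
    have hG := Complex.Gamma_ne_zero_of_re_pos hgσ
    have hG1 := Complex.Gamma_ne_zero_of_re_pos hσ1
    have hcast : (σ : ℂ) + (k + 1) = ((σ + 1 : ℝ) : ℂ) + k := by push_cast; ring
    rw [Complex.betaIntegral_eq_Gamma_mul_div _ _ (by simpa using hσ) (by simp; positivity),
      Complex.Gamma_nat_eq_factorial, hcast, Gamma_add_natCast (ne_neg_natCast_of_re_pos hσ1),
      norm_div, norm_mul, norm_mul, Complex.norm_natCast] at hb
    rw [Gamma_add_natCast (ne_neg_natCast_of_re_pos hgσ), mul_inv, norm_mul, norm_inv, norm_inv,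
      Real.rpow_neg (by linarith), hK, norm_inv]
    have h1 := hpk (show 0 < γ.re + σ by linarith) k
    have h2 := hpk (show 0 < σ + 1 by linarith) k
    have h3 := pochhammerC_ratio_le hγ hσ k
    have h4 : 0 < (1 - r) ^ σ := Real.rpow_pos_of_pos (by linarith) _
    have h5 := norm_pos_iff.2 hG
    have h6 := norm_pos_iff.2 hG1
    rw [← le_div_iff₀ h4] at hb
    refine hb.trans ?_
    have h7 : (k.factorial : ℝ) / ‖pochhammerC ((σ + 1 : ℝ) : ℂ) k‖ ≤
        ‖pochhammerC (γ.re : ℂ) k‖ / ‖pochhammerC ((γ.re + σ : ℝ) : ℂ) k‖ := by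
      rw [div_le_div_iff₀ h2 h1]; exact h3
    calc _ = σ * ‖Complex.Gamma (σ : ℂ)‖ * ‖Complex.Gamma ((σ + 1 : ℝ) : ℂ)‖⁻¹ * ((1 - r) ^ σ)⁻¹ *
          ((k.factorial : ℝ) / ‖pochhammerC ((σ + 1 : ℝ) : ℂ) k‖) := by
          field_simp
      _ ≤ σ * ‖Complex.Gamma (σ : ℂ)‖ * ‖Complex.Gamma ((σ + 1 : ℝ) : ℂ)‖⁻¹ * ((1 - r) ^ σ)⁻¹ *
          (‖pochhammerC (γ.re : ℂ) k‖ / ‖pochhammerC ((γ.re + σ : ℝ) : ℂ) k‖) := by gcongr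
      _ = _ := by field_simp
  intro κ hκ hκ1
  set X : ℝ := ∑' p : ℕ × ℕ, ‖appellNum α β δ a p‖ *
    ‖(Complex.Gamma (((γ.re + σ : ℝ) : ℂ) + (p.1 + p.2 : ℕ)))⁻¹‖ with hX
  have hX0 : 0 ≤ X := tsum_nonneg fun p => by positivity
  have hK0 : 0 ≤ K := by positivity
  refine ⟨K * (1 - κ) ^ (-σ) * X, fun t ht ht1 w hw => ?_⟩
  have hw1 := norm_le_of_norm_sub_le ht1 hw
  have hpos : 0 < (1 - κ) * t := mul_pos (by linarith) ht
  have hw2 : ‖w‖ < 1 := by linarith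
  have hbd : ∀ p : ℕ × ℕ, ‖appellCoeff α β δ a γ p * w ^ (p.1 + p.2)‖ ≤
      K * (1 - ‖w‖) ^ (-σ) * (‖appellNum α β δ a p‖ *
        ‖(Complex.Gamma (((γ.re + σ : ℝ) : ℂ) + (p.1 + p.2 : ℕ)))⁻¹‖) := by
    intro p
    have h0 : 0 ≤ (1 - ‖w‖) ^ (-σ) := Real.rpow_nonneg (by linarith) _
    rw [norm_mul, norm_pow]
    calc _ ≤ ‖appellCoeff α β δ a γ p‖ * (K * (1 - ‖w‖) ^ (-σ) *
          (‖pochhammerC (γ.re : ℂ) (p.1 + p.2)‖ *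
            ‖(Complex.Gamma (((γ.re + σ : ℝ) : ℂ) + (p.1 + p.2 : ℕ)))⁻¹‖)) := by
          gcongr
          exact hpow _ _ (norm_nonneg _) hw2
      _ = K * (1 - ‖w‖) ^ (-σ) * ((‖appellCoeff α β δ a γ p‖ *
          ‖pochhammerC (γ.re : ℂ) (p.1 + p.2)‖) *
            ‖(Complex.Gamma (((γ.re + σ : ℝ) : ℂ) + (p.1 + p.2 : ℕ)))⁻¹‖) := by ring
      _ ≤ _ := by
          gcongr
          exact norm_appellCoeff_le hγ0 p
  rw [appellDiag_eq_tsum]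
  refine (tsum_of_norm_bounded (hsum.hasSum.mul_left _) hbd).trans ?_
  rw [← hX]
  have hmono : (1 - ‖w‖) ^ (-σ) ≤ ((1 - κ) * t) ^ (-σ) :=
    Real.rpow_le_rpow_of_nonpos hpos (by linarith) (by linarith)
  rw [Real.mul_rpow (by linarith) ht.le] at hmono
  calc _ ≤ K * ((1 - κ) ^ (-σ) * t ^ (-σ)) * X := by gcongr
    _ = _ := by ring

/-! ### The Mellin transform of the kernel -/

open MeasureTheory in
theorem integral_norm_beta {u v : ℂ} (hu : 0 < u.re) (hv : 0 < v.re) :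
    ∫ t in Set.Ioo (0 : ℝ) 1, ‖(t : ℂ) ^ (u - 1) * (1 - (t : ℂ)) ^ (v - 1)‖ =
      ‖Complex.Gamma (u.re : ℂ) * Complex.Gamma (v.re : ℂ) *
        (Complex.Gamma ((u.re + v.re : ℝ) : ℂ))⁻¹‖ := by
  have h := Complex.betaIntegral_eq_Gamma_mul_div (u.re : ℂ) (v.re : ℂ) (by simpa) (by simpa)
  rw [div_eq_mul_inv, ← Complex.ofReal_add] at h
  rw [← h, Complex.betaIntegral, intervalIntegral.integral_of_le zero_le_one,
    integral_Ioc_eq_integral_Ioo]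
  have e : ∫ t in Set.Ioo (0 : ℝ) 1, (t : ℂ) ^ ((u.re : ℂ) - 1) * (1 - (t : ℂ)) ^ ((v.re : ℂ) - 1)
      = ((∫ t in Set.Ioo (0 : ℝ) 1, ‖(t : ℂ) ^ (u - 1) * (1 - (t : ℂ)) ^ (v - 1)‖ : ℝ) : ℂ) := by
    rw [← integral_complex_ofReal]
    refine setIntegral_congr_fun measurableSet_Ioo fun t ht => ?_
    have h1 : 0 < 1 - t := by linarith [ht.2]
    have e1 : 1 - (t : ℂ) = ((1 - t : ℝ) : ℂ) := by push_cast; rfl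
    rw [e1, norm_mul, Complex.norm_cpow_eq_rpow_re_of_pos ht.1,
      Complex.norm_cpow_eq_rpow_re_of_pos h1, Complex.ofReal_mul, Complex.ofReal_cpow ht.1.le,
      Complex.ofReal_cpow h1.le]
    simp
  rw [e, Complex.norm_real, Real.norm_of_nonneg (integral_nonneg fun _ => norm_nonneg _)]

/-- Termwise integration against the Beta kernel, then Gauss's theorem for the sum over `n` and
again for the sum over `m`. -/
theorem integral_appellDiag_of_re_pos {α β δ a γ ρ : ℂ} (ha : 0 < a.re) (hγ : 0 < γ.re)
    (hρ : 0 < ρ.re) (h₁ : a.re + δ.re < γ.re + ρ.re)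
    (h₂ : α.re + β.re + a.re < γ.re + ρ.re) :
    ∫ t in (0 : ℝ)..1, (t : ℂ) ^ (ρ - 1) * (1 - (t : ℂ)) ^ (γ - 1) *
        appellDiag α β δ a γ (1 - (t : ℂ)) =
      Complex.Gamma γ * gammaRatio ρ (ρ + γ - α - a - β) (ρ + γ - δ - a)
        (ρ + γ - δ) (ρ + γ - α - a) (ρ + γ - a - β) := by
  have hγk : ∀ k : ℕ, 0 < (γ + k).re := fun k => by simp; positivity
  set F : ℕ × ℕ → ℝ → ℂ := fun p t => appellCoeff α β δ a γ p *
    ((t : ℂ) ^ (ρ - 1) * (1 - (t : ℂ)) ^ (γ + (p.1 + p.2 : ℕ) - 1)) with hF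
  have hFint : ∀ p, MeasureTheory.Integrable (F p)
      (MeasureTheory.volume.restrict (Set.Ioo (0 : ℝ) 1)) := fun p =>
    MeasureTheory.Integrable.const_mul (MeasureTheory.IntegrableOn.mono_set
      (Complex.betaIntegral_convergent hρ (hγk (p.1 + p.2))).1 Set.Ioo_subset_Ioc_self) _
  have hFnorm : Summable fun p => ∫ t in Set.Ioo (0 : ℝ) 1, ‖F p t‖ := by
    have hs := (summable_norm_appellNum_mul ha h₁ h₂).mul_left
      (‖Complex.Gamma (ρ.re : ℂ)‖ * ‖Complex.Gamma (γ.re : ℂ)‖)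
    refine hs.of_nonneg_of_le (fun p => MeasureTheory.integral_nonneg fun _ => norm_nonneg _)
      fun p => ?_
    simp only [hF]
    simp_rw [norm_mul (appellCoeff α β δ a γ p)]
    rw [MeasureTheory.integral_const_mul, integral_norm_beta hρ (hγk _)]
    have hcast : (((γ + (p.1 + p.2 : ℕ)).re : ℝ) : ℂ) = (γ.re : ℂ) + (p.1 + p.2 : ℕ) := by
      simp
    have hcast2 : ((ρ.re + (γ + (p.1 + p.2 : ℕ)).re : ℝ) : ℂ) =
        ((γ.re + ρ.re : ℝ) : ℂ) + (p.1 + p.2 : ℕ) := by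
      rw [Complex.ofReal_add, hcast]; push_cast; ring
    have hg : 0 < (γ.re : ℂ).re := by simpa
    rw [hcast, hcast2, Gamma_add_natCast (ne_neg_natCast_of_re_pos hg), norm_mul, norm_mul,
      norm_mul]
    calc _ = ‖Complex.Gamma (ρ.re : ℂ)‖ * ‖Complex.Gamma (γ.re : ℂ)‖ *
          ((‖appellCoeff α β δ a γ p‖ * ‖pochhammerC (γ.re : ℂ) (p.1 + p.2)‖) *
            ‖(Complex.Gamma (((γ.re + ρ.re : ℝ) : ℂ) + (p.1 + p.2 : ℕ)))⁻¹‖) := by ring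
      _ ≤ _ := by
          gcongr
          exact norm_appellCoeff_le hγ p
  have hsum := MeasureTheory.hasSum_integral_of_summable_integral_norm hFint hFnorm
  have hval : ∀ p : ℕ × ℕ, ∫ t in Set.Ioo (0 : ℝ) 1, F p t =
      Complex.Gamma ρ * Complex.Gamma γ *
        (pochhammerC α p.1 * pochhammerC β p.1 / (p.1.factorial : ℂ) *
          gaussTerm a (δ + p.1) (ρ + γ + p.1) p.2) := by
    intro p
    simp only [hF]
    rw [MeasureTheory.integral_const_mul, ← MeasureTheory.integral_Ioc_eq_integral_Ioo,
      ← intervalIntegral.integral_of_le zero_le_one]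
    have hb := Complex.betaIntegral_eq_Gamma_mul_div ρ (γ + (p.1 + p.2 : ℕ)) hρ (hγk _)
    rw [Complex.betaIntegral] at hb
    rw [hb, Gamma_add_natCast (ne_neg_natCast_of_re_pos hγ), appellCoeff, appellNum, gaussTerm,
      show ρ + (γ + (p.1 + p.2 : ℕ)) = ρ + γ + p.1 + p.2 by push_cast; ring]
    have := pochhammerC_ne_zero (add_natCast_ne_zero_of_re_pos hγ) (p.1 + p.2)
    field_simp
  have hfun : ∫ t in (0 : ℝ)..1, (t : ℂ) ^ (ρ - 1) * (1 - (t : ℂ)) ^ (γ - 1) *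
        appellDiag α β δ a γ (1 - (t : ℂ)) = ∫ t in Set.Ioo (0 : ℝ) 1, ∑' p, F p t := by
    rw [intervalIntegral.integral_of_le zero_le_one, MeasureTheory.integral_Ioc_eq_integral_Ioo]
    refine MeasureTheory.setIntegral_congr_fun measurableSet_Ioo fun t ht => ?_
    have h1 : (1 - (t : ℂ)) ≠ 0 := by
      rw [← Complex.ofReal_one, ← Complex.ofReal_sub]
      exact_mod_cast (sub_pos.2 ht.2).ne'
    simp only [hF]
    rw [appellDiag_eq_tsum, ← tsum_mul_left]
    refine tsum_congr fun p => ?_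
    rw [show γ + ((p.1 + p.2 : ℕ) : ℂ) - 1 = γ - 1 + (p.1 + p.2 : ℕ) by ring,
      Complex.cpow_add _ _ h1, Complex.cpow_natCast]
    ring
  rw [hfun, ← hsum.tsum_eq, hsum.summable.tsum_prod]
  simp only [hval, tsum_mul_left]
  have hrow : ∀ m : ℕ, ∑' n, gaussTerm a (δ + m) (ρ + γ + m) n =
      Complex.Gamma (ρ + γ - a - δ) * (Complex.Gamma (ρ + γ - δ))⁻¹ *
        (Complex.Gamma (ρ + γ - a + m))⁻¹ := by
    intro m
    rw [tsum_gaussTerm (by simp; linarith), show ρ + γ + m - a - (δ + m) = ρ + γ - a - δ by ring,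
      show ρ + γ + m - a = ρ + γ - a + m by ring, show ρ + γ + m - (δ + m) = ρ + γ - δ by ring]
    ring
  have hcol : ∑' m : ℕ, pochhammerC α m * pochhammerC β m / (m.factorial : ℂ) *
      ∑' n, gaussTerm a (δ + m) (ρ + γ + m) n =
      Complex.Gamma (ρ + γ - a - δ) * (Complex.Gamma (ρ + γ - δ))⁻¹ *
        ∑' m, gaussTerm α β (ρ + γ - a) m := by
    rw [← tsum_mul_left]
    refine tsum_congr fun m => ?_
    rw [hrow, gaussTerm]
    ring
  rw [hcol, tsum_gaussTerm (by simp; linarith), gammaRatio,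
    show ρ + γ - a - α - β = ρ + γ - α - a - β by ring, show ρ + γ - a - α = ρ + γ - α - a by ring,
    show ρ + γ - a - δ = ρ + γ - δ - a by ring]
  simp only [div_eq_mul_inv, mul_inv]
  ring

/-! ### Raising the parameters -/

theorem hasSum_mul_deriv_appellDiag (α β δ a : ℂ) {γ : ℂ} (hγ : 0 < γ.re) {u : ℂ}
    (hu : ‖u‖ < 1) :
    HasSum (fun p : ℕ × ℕ => appellCoeff α β δ a γ p * ((p.1 + p.2 : ℕ) * u ^ (p.1 + p.2)))
      (u * deriv (appellDiag α β δ a γ) u) := by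
  obtain ⟨r, hr, hr1⟩ := exists_between hu
  have hr0 : 0 ≤ r := (norm_nonneg u).trans hr.le
  have h := Complex.hasSum_deriv_of_summable_norm
    (F := fun (p : ℕ × ℕ) (w : ℂ) => appellCoeff α β δ a γ p * w ^ (p.1 + p.2))
    (summable_norm_appellCoeff_mul α β δ a hγ hr0 hr1 hr0 hr1)
    (fun p => by fun_prop) (Metric.isOpen_ball (x := (0 : ℂ)) (ε := r)) (fun p w hw => by
      rw [mem_ball_zero_iff] at hw
      rw [norm_mul, norm_pow, ← pow_add]
      gcongr) (show u ∈ Metric.ball 0 r by simpa using hr)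
  have h' := h.mul_left u
  rw [show (fun w : ℂ => ∑' p : ℕ × ℕ, appellCoeff α β δ a γ p * w ^ (p.1 + p.2)) =
    appellDiag α β δ a γ from funext fun w => (appellDiag_eq_tsum α β δ a γ w).symm] at h'
  refine h'.congr_fun fun p => ?_
  rw [deriv_const_mul _ (by fun_prop), deriv_pow_field]
  rcases Nat.eq_zero_or_pos (p.1 + p.2) with h0 | h0
  · simp [h0]
  · obtain ⟨k, hk⟩ := Nat.exists_eq_add_of_lt h0
    rw [hk]
    simp [pow_succ]
    ring

/-- The kernel with parameters `a, γ` is the image of the one with parameters `a + 1, γ + 1` under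
a first-order differential operator. On coefficients this is the recurrence
`(a)_n / n! = (a + 1)_n / n! - (a + 1)_{n - 1} / (n - 1)!`. -/
theorem appellDiag_raise (α β δ a : ℂ) {γ : ℂ} (hγ : 0 < γ.re) {u : ℂ} (hu : ‖u‖ < 1) :
    γ * appellDiag α β δ a γ u = (γ - δ) * u * appellDiag α β δ (a + 1) (γ + 1) u +
      (1 - u) * (γ * appellDiag α β δ (a + 1) (γ + 1) u +
        u * deriv (appellDiag α β δ (a + 1) (γ + 1)) u) := by
  have hγ1 : 0 < (γ + 1).re := by simp; linarith
  have hγ' := add_natCast_ne_zero_of_re_pos hγ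
  have hγ0 : γ ≠ 0 := by simpa using hγ' 0
  have h1 := summable_appellCoeff_mul_pow α β δ (a + 1) hγ1 hu
  have hs1 := h1.hasSum
  rw [← appellDiag_eq_tsum] at hs1
  have hs2 := hasSum_mul_deriv_appellDiag α β δ (a + 1) hγ1 hu
  -- the parts of the right-hand side without and with a factor `u`
  have hA := (hs1.mul_left γ).add hs2
  have hB := ((hs1.mul_left δ).add hs2).mul_left u
  -- the second part, with the index `n` raised by one
  have hinj : Function.Injective fun p : ℕ × ℕ => (p.1, p.2 + 1) := by
    rintro ⟨m, n⟩ ⟨m', n'⟩ h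
    simpa using h
  set B : ℕ × ℕ → ℂ := fun p => pochhammerC α p.1 * pochhammerC β p.1 / (p.1.factorial : ℂ) *
    (pochhammerC (a + 1) (p.2 - 1) / ((p.2 - 1).factorial : ℂ) * (if p.2 = 0 then 0 else 1)) *
    pochhammerC (δ + p.1) p.2 / pochhammerC γ (p.1 + p.2) * (γ * u ^ (p.1 + p.2)) with hBdef
  have hshift : ∀ k : ℕ, pochhammerC γ (k + 1) = γ * pochhammerC (γ + 1) k :=
    pochhammerC_succ_left γ
  have hB' : HasSum B (u * (δ * appellDiag α β δ (a + 1) (γ + 1) u +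
      u * deriv (appellDiag α β δ (a + 1) (γ + 1)) u)) := by
    rw [← hinj.hasSum_iff]
    · refine hB.congr_fun fun p => ?_
      have hne := pochhammerC_ne_zero hγ' (p.1 + p.2 + 1)
      rw [hshift] at hne
      have hne2 := right_ne_zero_of_mul hne
      simp only [hBdef, Function.comp, appellCoeff, appellNum, Nat.add_sub_cancel,
        pochhammerC_succ (δ + p.1)]
      rw [show p.1 + (p.2 + 1) = p.1 + p.2 + 1 by ring, hshift, pow_succ]
      push_cast
      simp
      field_simp
      ring
    · rintro ⟨m, n⟩ hmn
      rcases n with _ | n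
      · simp [hBdef]
      · exact absurd ⟨(m, n), rfl⟩ hmn
  have hAB := hA.sub hB'
  have hL := ((summable_appellCoeff_mul_pow α β δ a hγ hu).hasSum).mul_left γ
  rw [← appellDiag_eq_tsum] at hL
  have huniq := hL.unique (hAB.congr_fun fun p => ?_)
  · rw [huniq]; ring
  · obtain ⟨m, n⟩ := p
    have hne := pochhammerC_ne_zero hγ' (m + n)
    have hne' := pochhammerC_ne_zero hγ' (m + n + 1)
    have e : γ * pochhammerC (γ + 1) (m + n) = pochhammerC γ (m + n) * (γ + (m + n : ℕ)) := by
      rw [← hshift, pochhammerC_succ]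
    have hne1 : pochhammerC (γ + 1) (m + n) ≠ 0 := by
      rw [hshift] at hne'
      exact right_ne_zero_of_mul hne'
    have hrec : pochhammerC a n / (n.factorial : ℂ) = pochhammerC (a + 1) n / (n.factorial : ℂ) -
        pochhammerC (a + 1) (n - 1) / ((n - 1).factorial : ℂ) * (if n = 0 then 0 else 1) := by
      rcases n with _ | n
      · simp [pochhammerC_zero]
      · have hf : (n.factorial : ℂ) ≠ 0 := by exact_mod_cast n.factorial_ne_zero
        have hn : (n : ℂ) + 1 ≠ 0 := by exact_mod_cast n.succ_ne_zero
        simp only [Nat.add_sub_cancel, Nat.succ_ne_zero, if_false, mul_one]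
        rw [pochhammerC_succ_left, pochhammerC_succ, Nat.factorial_succ]
        push_cast
        field_simp
        ring
    have hfirst : γ * (appellCoeff α β δ (a + 1) (γ + 1) (m, n) * u ^ (m + n)) +
        appellCoeff α β δ (a + 1) (γ + 1) (m, n) * ((m + n : ℕ) * u ^ (m + n)) =
        appellNum α β δ (a + 1) (m, n) / pochhammerC γ (m + n) * (γ * u ^ (m + n)) := by
      simp only [appellCoeff]
      field_simp
      linear_combination (-u ^ (m + n)) * appellNum α β δ (a + 1) (m, n) * e
    simp only at hfirst ⊢
    rw [hfirst]
    simp only [hBdef, appellCoeff, appellNum, hrec]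
    ring

theorem NontangentialGrowth.one_sub_mul_deriv {σ : ℝ} {h : ℂ → ℂ} (hg : NontangentialGrowth σ h)
    (hd : DifferentiableOn ℂ h (Metric.ball 0 1)) :
    NontangentialGrowth σ fun w => (1 - w) * deriv h w := by
  intro κ hκ hκ1
  -- Cauchy's estimate on a disc that stays inside a slightly larger approach region
  set κ' : ℝ := (1 + κ) / 2 with hκ'
  obtain ⟨C, hC⟩ := hg κ' (by linarith) (by linarith)
  refine ⟨2 * C / (κ' - κ), fun t ht ht1 w hw => ?_⟩
  have hR : 0 < (κ' - κ) * t := mul_pos (by linarith) ht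
  have hin : ∀ z : ℂ, dist z w ≤ (κ' - κ) * t → ‖z - ((1 - t : ℝ) : ℂ)‖ ≤ κ' * t := by
    intro z hz
    rw [dist_eq_norm] at hz
    calc ‖z - ((1 - t : ℝ) : ℂ)‖ = ‖(z - w) + (w - ((1 - t : ℝ) : ℂ))‖ := by ring_nf
      _ ≤ (κ' - κ) * t + κ * t := (norm_add_le _ _).trans (add_le_add hz hw)
      _ = κ' * t := by ring
  have hsub : Metric.closedBall w ((κ' - κ) * t) ⊆ Metric.ball 0 1 := by
    intro z hz
    have := norm_le_of_norm_sub_le ht1 (hin z hz)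
    rw [mem_ball_zero_iff]
    nlinarith
  have hder := Complex.norm_deriv_le_of_forall_mem_sphere_norm_le hR
    ((hd.mono (Metric.closure_ball_subset_closedBall.trans hsub)).diffContOnCl)
    (fun z hz => hC t ht ht1 z (hin z (Metric.mem_sphere.1 hz).le))
  have h1w : ‖1 - w‖ ≤ 2 * t := by
    calc ‖1 - w‖ = ‖(t : ℂ) - (w - ((1 - t : ℝ) : ℂ))‖ := by push_cast; ring_nf
      _ ≤ ‖(t : ℂ)‖ + κ * t := (norm_sub_le _ _).trans (add_le_add le_rfl hw)
      _ ≤ 2 * t := by rw [Complex.norm_real, Real.norm_of_nonneg ht.le]; nlinarith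
  rw [norm_mul]
  have hκκ : κ' - κ ≠ 0 := by
    have : 0 < κ' - κ := by linarith
    exact this.ne'
  calc _ ≤ 2 * t * (C * t ^ (-σ) / ((κ' - κ) * t)) :=
        mul_le_mul h1w hder (norm_nonneg _) (by linarith)
    _ = _ := by field_simp

theorem nontangentialGrowth_appellDiag_raise {α β δ a γ : ℂ} {σ : ℝ} (hγ : 0 < γ.re)
    (h : NontangentialGrowth σ (appellDiag α β δ (a + 1) (γ + 1))) :
    NontangentialGrowth σ (appellDiag α β δ a γ) := by
  intro κ hκ hκ1
  have hγ1 : 0 < (γ + 1).re := by simp; linarith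
  have hγ0 : γ ≠ 0 := by
    rintro rfl
    simp at hγ
  obtain ⟨C₁, h₁⟩ := h κ hκ hκ1
  obtain ⟨C₂, h₂⟩ := h.one_sub_mul_deriv (differentiableOn_appellDiag α β δ (a + 1) hγ1) κ hκ hκ1
  refine ⟨(‖γ - δ‖ / ‖γ‖ + 2) * C₁ + C₂ / ‖γ‖, fun t ht ht1 w hw => ?_⟩
  have hw1 := norm_le_of_norm_sub_le ht1 hw
  have hw2 : ‖w‖ < 1 := by nlinarith
  have e := appellDiag_raise α β δ a hγ hw2
  have e2 : appellDiag α β δ a γ w = ((γ - δ) / γ * w + (1 - w)) *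
      appellDiag α β δ (a + 1) (γ + 1) w +
      w / γ * ((1 - w) * deriv (appellDiag α β δ (a + 1) (γ + 1)) w) := by
    field_simp
    linear_combination e
  have b₁ := h₁ t ht ht1 w hw
  have b₂ := h₂ t ht ht1 w hw
  have b₃ : ‖(γ - δ) / γ * w + (1 - w)‖ ≤ ‖γ - δ‖ / ‖γ‖ + 2 := by
    refine (norm_add_le _ _).trans (add_le_add ?_ ?_)
    · rw [norm_mul, norm_div]
      exact mul_le_of_le_one_right (by positivity) hw2.le
    · refine (norm_sub_le _ _).trans ?_
      rw [norm_one]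
      linarith
  have b₄ : ‖w / γ‖ ≤ 1 / ‖γ‖ := by
    rw [norm_div]
    gcongr
  rw [e2]
  calc _ ≤ (‖γ - δ‖ / ‖γ‖ + 2) * (C₁ * t ^ (-σ)) + 1 / ‖γ‖ * (C₂ * t ^ (-σ)) := by
        refine (norm_add_le _ _).trans (add_le_add ?_ ?_)
        · rw [norm_mul]
          exact mul_le_mul b₃ b₁ (norm_nonneg _) (by positivity)
        · rw [norm_mul (w / γ)]
          exact mul_le_mul b₄ b₂ (norm_nonneg _) (by positivity)
    _ = _ := by ring

/-- `N` counts the raising steps that lead to `0 < a.re` and `1 ≤ γ.re`. They leave `a - γ`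
unchanged, and with it the conditions on `σ`. -/
theorem nontangentialGrowth_appellDiag {α β δ : ℂ} {σ : ℝ} (hσ : 0 < σ) (N : ℕ) :
    ∀ a γ : ℂ, 0 < γ.re → -(N : ℝ) < a.re → 1 ≤ γ.re + N → a.re + δ.re < γ.re + σ →
      α.re + β.re + a.re < γ.re + σ → NontangentialGrowth σ (appellDiag α β δ a γ) := by
  induction N with
  | zero =>
    intro a γ _ ha hγ h₁ h₂
    exact nontangentialGrowth_appellDiag_of_re_pos (by simpa using ha) (by simpa using hγ) hσ h₁ h₂
  | succ N ih =>
    intro a γ hγ ha hγ1 h₁ h₂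
    push_cast at ha hγ1
    refine nontangentialGrowth_appellDiag_raise hγ (ih _ _ ?_ ?_ ?_ ?_ ?_) <;> simp <;> linarith

/-! ### The Mellin transform in the full range of parameters -/

/-- The integrand of the Mellin transform, in the variable `t` scaled to `(0, 1)`. -/
noncomputable def mellinIntegrand (ρ γ : ℂ) (h : ℂ → ℂ) (t : ℝ) : ℂ :=
  (t : ℂ) ^ (ρ - 1) * (1 - (t : ℂ)) ^ (γ - 1) * h (1 - (t : ℂ))

theorem NontangentialGrowth.exists_norm_le {σ : ℝ} {h : ℂ → ℂ} (hg : NontangentialGrowth σ h) :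
    ∃ C : ℝ, ∀ t : ℝ, 0 < t → t ≤ 1 → ‖h (1 - (t : ℂ))‖ ≤ C * t ^ (-σ) := by
  obtain ⟨C, hC⟩ := hg (1 / 2) (by norm_num) (by norm_num)
  refine ⟨C, fun t ht ht1 => hC t ht ht1 _ ?_⟩
  push_cast
  simp
  linarith

theorem continuousOn_comp_one_sub {h : ℂ → ℂ} (hd : DifferentiableOn ℂ h (Metric.ball 0 1)) :
    ContinuousOn (fun t : ℝ => h (1 - (t : ℂ))) (Set.Ioo 0 1) := by
  refine hd.continuousOn.comp (by fun_prop) fun t ht => ?_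
  rw [mem_ball_zero_iff, ← Complex.ofReal_one, ← Complex.ofReal_sub, Complex.norm_real,
    Real.norm_of_nonneg (by linarith [ht.2])]
  linarith [ht.1]

theorem continuousOn_mellinIntegrand (ρ γ : ℂ) {h : ℂ → ℂ}
    (hd : DifferentiableOn ℂ h (Metric.ball 0 1)) :
    ContinuousOn (mellinIntegrand ρ γ h) (Set.Ioo 0 1) := by
  refine ContinuousOn.mul (ContinuousOn.mul ?_ ?_) (continuousOn_comp_one_sub hd)
  · exact ContinuousOn.cpow_const (by fun_prop) fun t ht =>
      Complex.ofReal_mem_slitPlane.2 ht.1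
  · refine ContinuousOn.cpow_const (by fun_prop) fun t ht => ?_
    rw [← Complex.ofReal_one, ← Complex.ofReal_sub]
    exact Complex.ofReal_mem_slitPlane.2 (sub_pos.2 ht.2)

theorem integrableOn_mellinIntegrand {σ : ℝ} {ρ γ : ℂ} {h : ℂ → ℂ}
    (hd : DifferentiableOn ℂ h (Metric.ball 0 1)) (hg : NontangentialGrowth σ h)
    (hσ : σ < ρ.re) (hγ : 0 < γ.re) :
    MeasureTheory.IntegrableOn (mellinIntegrand ρ γ h) (Set.Ioo 0 1) := by
  obtain ⟨C, hC⟩ := hg.exists_norm_le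
  have hint := ((Complex.betaIntegral_convergent (u := ρ - σ) (v := γ)
    (by simpa using hσ) hγ).1.mono_set Set.Ioo_subset_Ioc_self).norm.const_mul C
  refine MeasureTheory.Integrable.mono' hint
    ((continuousOn_mellinIntegrand ρ γ hd).aestronglyMeasurable measurableSet_Ioo) ?_
  refine (MeasureTheory.ae_restrict_iff' measurableSet_Ioo).2 (Filter.Eventually.of_forall ?_)
  intro t ht
  rw [mellinIntegrand, norm_mul, norm_mul, norm_mul, Complex.norm_cpow_eq_rpow_re_of_pos ht.1,
    Complex.norm_cpow_eq_rpow_re_of_pos ht.1]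
  have h1 := hC t ht.1 ht.2.le
  have e : t ^ (ρ - σ - 1 : ℂ).re = t ^ (ρ - 1 : ℂ).re * t ^ (-σ) := by
    rw [← Real.rpow_add ht.1]
    simp
    ring_nf
  rw [e]
  calc _ ≤ t ^ (ρ - 1 : ℂ).re * ‖(1 - (t : ℂ)) ^ (γ - 1)‖ * (C * t ^ (-σ)) := by
        exact mul_le_mul_of_nonneg_left h1
          (mul_nonneg (Real.rpow_nonneg ht.1.le _) (norm_nonneg _))
    _ = _ := by ring

theorem intervalIntegrable_mellinIntegrand {σ : ℝ} {ρ γ : ℂ} {h : ℂ → ℂ}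
    (hd : DifferentiableOn ℂ h (Metric.ball 0 1)) (hg : NontangentialGrowth σ h)
    (hσ : σ < ρ.re) (hγ : 0 < γ.re) :
    IntervalIntegrable (mellinIntegrand ρ γ h) MeasureTheory.volume 0 1 := by
  rw [intervalIntegrable_iff_integrableOn_Ioo_of_le zero_le_one]
  exact integrableOn_mellinIntegrand hd hg hσ hγ

/-- Raising `a` and `γ` by one multiplies the Mellin transform by a linear factor, by partial
integration; the boundary terms vanish by the growth condition. -/
theorem integral_mellinIntegrand_raise {α β δ a γ ρ : ℂ} {σ : ℝ} (hγ : 0 < γ.re)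
    (hσ : σ < ρ.re) (h : NontangentialGrowth σ (appellDiag α β δ (a + 1) (γ + 1))) :
    γ * ∫ t in (0 : ℝ)..1, mellinIntegrand ρ γ (appellDiag α β δ a γ) t =
      (γ - δ + ρ) *
        ∫ t in (0 : ℝ)..1, mellinIntegrand ρ (γ + 1) (appellDiag α β δ (a + 1) (γ + 1)) t := by
  have hγ1 : 0 < (γ + 1).re := by simp; linarith
  have hd := differentiableOn_appellDiag α β δ a hγ
  have hd1 := differentiableOn_appellDiag α β δ (a + 1) hγ1
  have hI := intervalIntegrable_mellinIntegrand hd (nontangentialGrowth_appellDiag_raise hγ h) hσ hγ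
  have hI1 := intervalIntegrable_mellinIntegrand hd1 h hσ hγ1
  set g := appellDiag α β δ (a + 1) (γ + 1) with hgdef
  set f : ℝ → ℂ := fun t => (t : ℂ) ^ ρ * (1 - (t : ℂ)) ^ γ * g (1 - (t : ℂ)) with hf
  have hderiv : ∀ t ∈ Set.Ioo (0 : ℝ) 1, HasDerivAt f
      ((γ - δ + ρ) * mellinIntegrand ρ (γ + 1) g t -
        γ * mellinIntegrand ρ γ (appellDiag α β δ a γ) t) t := by
    intro t ht
    have ht0 : (t : ℂ) ≠ 0 := by exact_mod_cast ht.1.ne'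
    have hcast : 1 - (t : ℂ) = ((1 - t : ℝ) : ℂ) := by push_cast; rfl
    have h1t : 1 - (t : ℂ) ≠ 0 := by
      rw [hcast]
      exact_mod_cast (sub_pos.2 ht.2).ne'
    have hnorm : ‖1 - (t : ℂ)‖ < 1 := by
      rw [hcast, Complex.norm_real, Real.norm_of_nonneg (by linarith [ht.2])]
      linarith [ht.1]
    have d0 : HasDerivAt (fun z : ℂ => 1 - z) (-1) (t : ℂ) := (hasDerivAt_id _).const_sub 1
    have d1 : HasDerivAt (fun z : ℂ => z ^ ρ) (ρ * (t : ℂ) ^ (ρ - 1) * 1) (t : ℂ) :=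
      (hasDerivAt_id (t : ℂ)).cpow_const (Complex.ofReal_mem_slitPlane.2 ht.1)
    have d2 : HasDerivAt (fun z : ℂ => (1 - z) ^ γ) (γ * (1 - (t : ℂ)) ^ (γ - 1) * (-1)) (t : ℂ) :=
      d0.cpow_const (by rw [hcast]; exact Complex.ofReal_mem_slitPlane.2 (sub_pos.2 ht.2))
    have d3 : HasDerivAt (fun z : ℂ => g (1 - z)) (deriv g (1 - (t : ℂ)) * (-1)) (t : ℂ) :=
      ((hd1.differentiableAt (Metric.isOpen_ball.mem_nhds
        (mem_ball_zero_iff.2 hnorm))).hasDerivAt).comp (t : ℂ) d0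
    have d4 := ((d1.mul d2).mul d3).comp_ofReal
    refine d4.congr_deriv ?_
    have e := appellDiag_raise α β δ a hγ hnorm
    rw [← hgdef] at e
    have e1 : (t : ℂ) ^ ρ = (t : ℂ) ^ (ρ - 1) * t := by
      rw [Complex.cpow_sub _ _ ht0, Complex.cpow_one]
      field_simp
    have e2 : (1 - (t : ℂ)) ^ γ = (1 - (t : ℂ)) ^ (γ - 1) * (1 - t) := by
      rw [Complex.cpow_sub _ _ h1t, Complex.cpow_one]
      field_simp
    simp only [mellinIntegrand, add_sub_cancel_right, Pi.mul_apply]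
    rw [e1, e2]
    linear_combination (t : ℂ) ^ (ρ - 1) * (1 - (t : ℂ)) ^ (γ - 1) * e
  obtain ⟨C, hC⟩ := h.exists_norm_le
  have hbound : ∀ t ∈ Set.Ioo (0 : ℝ) 1,
      ‖f t‖ ≤ C * (t ^ (ρ.re - σ) * (1 - t) ^ γ.re) := by
    intro t ht
    have h1t : 0 < 1 - t := by linarith [ht.2]
    have hcast : 1 - (t : ℂ) = ((1 - t : ℝ) : ℂ) := by push_cast; rfl
    have h2 : ‖(1 - (t : ℂ)) ^ γ‖ = (1 - t) ^ γ.re := by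
      rw [hcast, Complex.norm_cpow_eq_rpow_re_of_pos h1t]
    simp only [hf]
    rw [norm_mul, norm_mul, h2, Complex.norm_cpow_eq_rpow_re_of_pos ht.1,
      show ρ.re - σ = ρ.re + -σ from sub_eq_add_neg _ _, Real.rpow_add ht.1]
    calc _ ≤ t ^ ρ.re * (1 - t) ^ γ.re * (C * t ^ (-σ)) :=
          mul_le_mul_of_nonneg_left (hC t ht.1 ht.2.le)
            (mul_nonneg (Real.rpow_nonneg ht.1.le _) (Real.rpow_nonneg h1t.le _))
      _ = _ := by ring
  have hcont : Continuous fun t : ℝ => C * (t ^ (ρ.re - σ) * (1 - t) ^ γ.re) :=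
    continuous_const.mul ((Real.continuous_rpow_const (by linarith)).mul
      ((continuous_const.sub continuous_id).rpow_const fun _ => Or.inr hγ.le))
  have hlim0 : Filter.Tendsto f (𝓝[>] 0) (𝓝 0) := by
    refine squeeze_zero_norm' (a := fun t : ℝ => C * (t ^ (ρ.re - σ) * (1 - t) ^ γ.re)) ?_ ?_
    · filter_upwards [Ioo_mem_nhdsGT one_pos] with t ht using hbound t ht
    · have := (hcont.tendsto 0).mono_left (nhdsWithin_le_nhds (s := Set.Ioi 0))
      simpa [Real.zero_rpow (show ρ.re - σ ≠ 0 by linarith)] using this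
  have hlim1 : Filter.Tendsto f (𝓝[<] 1) (𝓝 0) := by
    refine squeeze_zero_norm' (a := fun t : ℝ => C * (t ^ (ρ.re - σ) * (1 - t) ^ γ.re)) ?_ ?_
    · filter_upwards [Ioo_mem_nhdsLT one_pos] with t ht using hbound t ht
    · have := (hcont.tendsto 1).mono_left (nhdsWithin_le_nhds (s := Set.Iio 1))
      simpa [Real.zero_rpow hγ.ne'] using this
  have hftc := intervalIntegral.integral_eq_sub_of_hasDerivAt_of_tendsto one_pos hderiv
    ((hI1.const_mul _).sub (hI.const_mul _)) hlim0 hlim1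
  rw [intervalIntegral.integral_sub (hI1.const_mul _) (hI.const_mul _),
    intervalIntegral.integral_const_mul, intervalIntegral.integral_const_mul, sub_zero] at hftc
  exact (sub_eq_zero.1 hftc).symm

/-- The Mellin transform of the kernel; `N` plays the same role as in
`nontangentialGrowth_appellDiag`. -/
theorem integral_mellinIntegrand_appellDiag {α β δ ρ : ℂ} (hρ : 0 < ρ.re) (N : ℕ) :
    ∀ a γ : ℂ, 0 < γ.re → -(N : ℝ) < a.re → 1 ≤ γ.re + N → a.re + δ.re < γ.re + ρ.re →
      α.re + β.re + a.re < γ.re + ρ.re →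
      ∫ t in (0 : ℝ)..1, mellinIntegrand ρ γ (appellDiag α β δ a γ) t =
        Complex.Gamma γ * gammaRatio ρ (ρ + γ - α - a - β) (ρ + γ - δ - a)
          (ρ + γ - δ) (ρ + γ - α - a) (ρ + γ - a - β) := by
  induction N with
  | zero =>
    intro a γ hγ ha _ h₁ h₂
    exact integral_appellDiag_of_re_pos (by simpa using ha) hγ hρ h₁ h₂
  | succ N ih =>
    intro a γ hγ ha hγ1 h₁ h₂
    push_cast at ha hγ1
    have hγ0 : γ ≠ 0 := by
      rintro rfl
      simp at hγ
    obtain ⟨σ, hσ, hσρ⟩ := exists_between (max_lt hρ (max_lt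
      (show a.re + δ.re - γ.re < ρ.re by linarith)
      (show α.re + β.re + a.re - γ.re < ρ.re by linarith)))
    rw [max_lt_iff, max_lt_iff] at hσ
    have hgrow : NontangentialGrowth σ (appellDiag α β δ (a + 1) (γ + 1)) := by
      refine nontangentialGrowth_appellDiag hσ.1 N _ _ ?_ ?_ ?_ ?_ ?_ <;> simp <;> linarith
    have h1 := integral_mellinIntegrand_raise hγ hσρ hgrow
    have h2 := ih (a + 1) (γ + 1) (by simp; linarith) (by simp; linarith) (by simp; linarith)
      (by simp; linarith) (by simp; linarith)
    rw [h2, Complex.Gamma_add_one _ hγ0] at h1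
    have h3 := mul_left_cancel₀ hγ0 (h1.trans (show _ = γ * (Complex.Gamma γ * ((γ - δ + ρ) *
      gammaRatio ρ (ρ + (γ + 1) - α - (a + 1) - β) (ρ + (γ + 1) - δ - (a + 1))
          (ρ + (γ + 1) - δ) (ρ + (γ + 1) - α - (a + 1)) (ρ + (γ + 1) - (a + 1) - β)) ) by ring))
    rw [h3]
    congr 1
    simp only [gammaRatio, div_eq_mul_inv, mul_inv]
    rw [Complex.one_div_Gamma_eq_self_mul_one_div_Gamma_add_one (ρ + γ - δ)]
    ring_nf

/-! ### The fractional integral of a cosine -/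

/-- By the duplication formula, applied also to `(2 j)! = (1)_{2 j}`, the half-integral parameters
combine in pairs to Pochhammer symbols of even order. -/
theorem genHypergeometricTerm_eq (α α' β β' γ ρ z : ℂ)
    (hlower : ∀ (j : Fin 7) (n : ℕ), lowerParams α α' β β' γ ρ j ≠ -(n : ℂ)) (j : ℕ) :
    genHypergeometricTerm (upperParams α α' β β' γ ρ) (lowerParams α α' β β' γ ρ) z j =
      pochhammerC ρ (2 * j) * pochhammerC (ρ + γ - α - α' - β) (2 * j) *
        pochhammerC (ρ + β' - α') (2 * j) /
      (pochhammerC (ρ + β') (2 * j) * pochhammerC (ρ + γ - α - α') (2 * j) *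
        pochhammerC (ρ + γ - α' - β) (2 * j)) * ((4 * z) ^ j / ((2 * j).factorial : ℂ)) := by
  have hl : ∀ i : Fin 7, pochhammerC (lowerParams α α' β β' γ ρ i) j ≠ 0 := fun i =>
    pochhammerC_ne_zero (fun n h => hlower i n (eq_neg_of_add_eq_zero_left h)) j
  have hf : pochhammerC 1 j ≠ 0 :=
    pochhammerC_ne_zero (add_natCast_ne_zero_of_re_pos (by simp)) j
  have h0 : pochhammerC (1 / 2) j ≠ 0 := hl 0
  have hup : ∏ i, pochhammerC (upperParams α α' β β' γ ρ i) j = pochhammerC (ρ / 2) j *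
      pochhammerC ((ρ + 1) / 2) j * pochhammerC ((ρ + γ - α - α' - β) / 2) j *
      pochhammerC ((ρ + γ - α - α' - β + 1) / 2) j * pochhammerC ((ρ + β' - α') / 2) j *
      pochhammerC ((ρ + β' - α' + 1) / 2) j := by
    rw [Fin.prod_univ_six]; rfl
  have hlow : ∏ i, pochhammerC (lowerParams α α' β β' γ ρ i) j = pochhammerC (1 / 2) j *
      pochhammerC ((ρ + β') / 2) j * pochhammerC ((ρ + β' + 1) / 2) j *
      pochhammerC ((ρ + γ - α - α') / 2) j * pochhammerC ((ρ + γ - α - α' + 1) / 2) j *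
      pochhammerC ((ρ + γ - α' - β) / 2) j * pochhammerC ((ρ + γ - α' - β + 1) / 2) j := by
    rw [Fin.prod_univ_seven]; rfl
  have h1 : pochhammerC ((ρ + β') / 2) j ≠ 0 := hl 1
  have h2 : pochhammerC ((ρ + β' + 1) / 2) j ≠ 0 := hl 2
  have h3 : pochhammerC ((ρ + γ - α - α') / 2) j ≠ 0 := hl 3
  have h4 : pochhammerC ((ρ + γ - α - α' + 1) / 2) j ≠ 0 := hl 4
  have h5 : pochhammerC ((ρ + γ - α' - β) / 2) j ≠ 0 := hl 5
  have h6 : pochhammerC ((ρ + γ - α' - β + 1) / 2) j ≠ 0 := hl 6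
  have h7 : ((1 : ℂ) + 1) / 2 = 1 := by norm_num
  rw [genHypergeometricTerm, hup, hlow, ← pochhammerC_one (2 * j)]
  simp only [pochhammerC_two_mul, mul_pow, h7]
  field_simp

theorem mellinIntegrand_add_natCast {ρ γ : ℂ} {h : ℂ → ℂ} {t : ℝ} (ht : 0 < t) (k : ℕ) :
    mellinIntegrand (ρ + k) γ h t = (t : ℂ) ^ k * mellinIntegrand ρ γ h t := by
  have ht0 : (t : ℂ) ≠ 0 := by exact_mod_cast ht.ne'
  rw [mellinIntegrand, mellinIntegrand, show ρ + k - 1 = ρ - 1 + k by ring,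
    Complex.cpow_add _ _ ht0, Complex.cpow_natCast]
  ring

/-- On `(0, x)` the integrand of the fractional integral is a rescaled Mellin integrand. -/
theorem msmIntegrand_eq (α α' β β' ρ : ℂ) {γ : ℂ} (hγ : 0 < γ.re) (g : ℝ → ℂ) {x t : ℝ}
    (ht : 0 < t) (htx : t < x) :
    msmIntegrand α α' β β' γ (fun t : ℝ => (t : ℂ) ^ (ρ - 1) * g t) x t =
      (x : ℂ) ^ (ρ - α' + γ - 2) *
        (mellinIntegrand ρ γ (appellDiag α β (γ - β') α' γ) (t / x) * g t) := by
  have hx : 0 < x := ht.trans htx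
  have hx0 : (x : ℂ) ≠ 0 := by exact_mod_cast hx.ne'
  have ht0 : (t : ℂ) ≠ 0 := by exact_mod_cast ht.ne'
  have hs : 0 < t / x := div_pos ht hx
  have hs1 : 0 < 1 - t / x := sub_pos.2 ((div_lt_one hx).2 htx)
  have e1 : ((x - t : ℝ) : ℂ) ^ (γ - 1) =
      (x : ℂ) ^ (γ - 1) * ((1 - t / x : ℝ) : ℂ) ^ (γ - 1) := by
    rw [← Complex.mul_cpow_ofReal_nonneg hx.le hs1.le, ← Complex.ofReal_mul]
    congr 2
    field_simp
  have e2 : (t : ℂ) ^ (-α') * ((x / t : ℝ) : ℂ) ^ (-α') = (x : ℂ) ^ (-α') := by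
    rw [← Complex.mul_cpow_ofReal_nonneg ht.le (by positivity), ← Complex.ofReal_mul]
    congr 2
    field_simp
  have e3 : (t : ℂ) ^ (ρ - 1) = (x : ℂ) ^ (ρ - 1) * ((t / x : ℝ) : ℂ) ^ (ρ - 1) := by
    rw [← Complex.mul_cpow_ofReal_nonneg hx.le hs.le, ← Complex.ofReal_mul]
    congr 2
    field_simp
  have e4 : (x : ℂ) ^ (ρ - α' + γ - 2) =
      (x : ℂ) ^ (γ - 1) * (x : ℂ) ^ (-α') * (x : ℂ) ^ (ρ - 1) := by
    rw [← Complex.cpow_add _ _ hx0, ← Complex.cpow_add _ _ hx0]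
    ring_nf
  rw [msmIntegrand, appellF3_kernel α α' β β' hγ ht htx, e1, e3, e4, ← e2, mellinIntegrand,
    appellDiag]
  push_cast
  ring

theorem gammaRatio_add_natCast {a b c d e f : ℂ} (ha : ∀ n : ℕ, a ≠ -n) (hb : ∀ n : ℕ, b ≠ -n)
    (hc : ∀ n : ℕ, c ≠ -n) (hd : ∀ n : ℕ, d ≠ -n) (he : ∀ n : ℕ, e ≠ -n) (hf : ∀ n : ℕ, f ≠ -n)
    (k : ℕ) :
    gammaRatio (a + k) (b + k) (c + k) (d + k) (e + k) (f + k) = gammaRatio a b c d e f *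
      (pochhammerC a k * pochhammerC b k * pochhammerC c k /
        (pochhammerC d k * pochhammerC e k * pochhammerC f k)) := by
  rw [gammaRatio, gammaRatio, Gamma_add_natCast ha, Gamma_add_natCast hb, Gamma_add_natCast hc,
    Gamma_add_natCast hd, Gamma_add_natCast he, Gamma_add_natCast hf, div_mul_div_comm]
  congr 1 <;> ring

/-- The cosine is expanded into its power series and integrated term by term; the powers of `t`
shift `ρ` by even integers. -/
theorem msmIntegral_cos (α α' β β' γ ρ c : ℂ) (x : ℝ) (hx : 0 < x) (hγ : 0 < γ.re)
    (hρ : max 0 (max (α + α' + β - γ).re (α' - β').re) < ρ.re)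
    (hlower : ∀ (j : Fin 7) (n : ℕ), lowerParams α α' β β' γ ρ j ≠ -(n : ℂ)) :
    IntervalIntegrable
        (msmIntegrand α α' β β' γ (fun t : ℝ => (t : ℂ) ^ (ρ - 1) * Complex.cos (c * t)) x)
        MeasureTheory.volume 0 x ∧
      Summable (genHypergeometricTerm (upperParams α α' β β' γ ρ) (lowerParams α α' β β' γ ρ)
        (-(c ^ 2 * (x : ℂ) ^ 2 / 4))) ∧
      msmIntegral α α' β β' γ (fun t : ℝ => (t : ℂ) ^ (ρ - 1) * Complex.cos (c * t)) x =
        gammaRatio ρ (ρ + γ - α - α' - β) (ρ + β' - α')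
            (ρ + β') (ρ + γ - α - α') (ρ + γ - α' - β) *
          (x : ℂ) ^ (ρ - α - α' + γ - 1) *
          genHypergeometric (upperParams α α' β β' γ ρ) (lowerParams α α' β β' γ ρ)
            (-(c ^ 2 * (x : ℂ) ^ 2 / 4)) := by
  rw [max_lt_iff, max_lt_iff] at hρ
  obtain ⟨hρ0, hρ1, hρ2⟩ := hρ
  simp only [Complex.add_re, Complex.sub_re] at hρ1 hρ2
  have hx0 : (x : ℂ) ≠ 0 := by exact_mod_cast hx.ne'
  set δ : ℂ := γ - β' with hδ
  have hδre : δ.re = γ.re - β'.re := by simp [hδ]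
  set h := appellDiag α β δ α' γ with hh
  have hd : DifferentiableOn ℂ h (Metric.ball 0 1) := differentiableOn_appellDiag α β δ α' hγ
  obtain ⟨N, hN⟩ := exists_nat_gt (max (-α'.re) (1 - γ.re))
  rw [max_lt_iff] at hN
  obtain ⟨σ, hσ, hσρ⟩ := exists_between (max_lt hρ0 (max_lt hρ1 hρ2))
  rw [max_lt_iff, max_lt_iff] at hσ
  have hgrow : NontangentialGrowth σ h := nontangentialGrowth_appellDiag hσ.1 N α' γ hγ
    (by linarith) (by linarith) (by linarith) (by linarith)
  have hmellin : ∀ k : ℕ, ∫ t in (0 : ℝ)..1, mellinIntegrand (ρ + k) γ h t =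
      Complex.Gamma γ * gammaRatio (ρ + k) (ρ + γ - α - α' - β + k) (ρ + β' - α' + k)
          (ρ + β' + k) (ρ + γ - α - α' + k) (ρ + γ - α' - β + k) := by
    intro k
    have hk : (0 : ℝ) ≤ k := Nat.cast_nonneg k
    have hre : (ρ + k).re = ρ.re + k := by simp
    rw [hh, integral_mellinIntegrand_appellDiag (by rw [hre]; linarith) N α' γ hγ (by linarith)
      (by linarith) (by rw [hre]; linarith) (by rw [hre]; linarith), hδ]
    ring_nf
  -- the lower parameters come in pairs `a / 2, (a + 1) / 2`
  have hhalf : ∀ (a : ℂ) (i i' : Fin 7), lowerParams α α' β β' γ ρ i = a / 2 →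
      lowerParams α α' β β' γ ρ i' = (a + 1) / 2 → ∀ n : ℕ, a ≠ -n := by
    intro a i i' hi hi' n hn
    obtain ⟨k, rfl | rfl⟩ := Nat.even_or_odd' n
    · refine hlower i k ?_
      rw [hi, hn]; push_cast; ring
    · refine hlower i' k ?_
      rw [hi', hn]; push_cast; ring
  have n1 : ∀ n : ℕ, ρ ≠ -n := ne_neg_natCast_of_re_pos hρ0
  have n2 : ∀ n : ℕ, ρ + γ - α - α' - β ≠ -n := ne_neg_natCast_of_re_pos (by simp; linarith)
  have n3 : ∀ n : ℕ, ρ + β' - α' ≠ -n := ne_neg_natCast_of_re_pos (by simp; linarith)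
  have n4 : ∀ n : ℕ, ρ + β' ≠ -n := hhalf _ 1 2 rfl rfl
  have n5 : ∀ n : ℕ, ρ + γ - α - α' ≠ -n := hhalf _ 3 4 rfl rfl
  have n6 : ∀ n : ℕ, ρ + γ - α' - β ≠ -n := hhalf _ 5 6 rfl rfl
  set R := gammaRatio ρ (ρ + γ - α - α' - β) (ρ + β' - α')
            (ρ + β') (ρ + γ - α - α') (ρ + γ - α' - β) with hR
  have hR0 : R ≠ 0 := by
    rw [hR, gammaRatio]
    have g1 := Complex.Gamma_ne_zero n1
    have g2 := Complex.Gamma_ne_zero n2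
    have g3 := Complex.Gamma_ne_zero n3
    have g4 := Complex.Gamma_ne_zero n4
    have g5 := Complex.Gamma_ne_zero n5
    have g6 := Complex.Gamma_ne_zero n6
    positivity
  have hG0 : Complex.Gamma γ ≠ 0 := Complex.Gamma_ne_zero_of_re_pos hγ
  set z : ℂ := -(c ^ 2 * (x : ℂ) ^ 2 / 4) with hz
  set T := genHypergeometricTerm (upperParams α α' β β' γ ρ) (lowerParams α α' β β' γ ρ) z with hT
  -- integration of the cosine series against the Mellin kernel on `(0, 1)`
  set F : ℕ → ℝ → ℂ := fun j s => (-1) ^ j * (c * x) ^ (2 * j) / ((2 * j).factorial : ℂ) *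
    mellinIntegrand (ρ + (2 * j : ℕ)) γ h s with hF
  have hint : ∀ k : ℕ, MeasureTheory.IntegrableOn (mellinIntegrand (ρ + k) γ h)
      (Set.Ioo 0 1) := fun k => by
    refine integrableOn_mellinIntegrand hd hgrow ?_ hγ
    have hk : (0 : ℝ) ≤ k := Nat.cast_nonneg k
    simp
    linarith
  have hint0 := hint 0
  rw [Nat.cast_zero, add_zero] at hint0
  have hFsum : HasSum (fun j => ∫ s in Set.Ioo (0 : ℝ) 1, F j s)
      (∫ s in Set.Ioo (0 : ℝ) 1, ∑' j, F j s) := by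
    refine MeasureTheory.hasSum_integral_of_summable_integral_norm
      (fun j => (hint (2 * j)).const_mul _) ?_
    have hcosh := ((Real.hasSum_cosh ‖c * x‖).summable).mul_right
      (∫ s in Set.Ioo (0 : ℝ) 1, ‖mellinIntegrand ρ γ h s‖)
    refine hcosh.of_nonneg_of_le
      (fun j => MeasureTheory.integral_nonneg fun _ => norm_nonneg _) fun j => ?_
    rw [← MeasureTheory.integral_const_mul]
    refine MeasureTheory.setIntegral_mono_on ((hint (2 * j)).const_mul _).norm
      (hint0.norm.const_mul _) measurableSet_Ioo fun s hs => ?_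
    simp only [hF]
    rw [mellinIntegrand_add_natCast hs.1, norm_mul, norm_mul ((s : ℂ) ^ (2 * j)), norm_div,
      norm_mul, norm_pow, norm_pow, norm_pow, norm_neg, norm_one, one_pow, one_mul,
      Complex.norm_natCast, Complex.norm_real, Real.norm_of_nonneg hs.1.le]
    exact mul_le_mul_of_nonneg_left (mul_le_of_le_one_left (norm_nonneg _)
      (pow_le_one₀ hs.1.le hs.2.le)) (by positivity)
  have hterm : ∀ j, ∫ s in Set.Ioo (0 : ℝ) 1, F j s = Complex.Gamma γ * R * T j := by
    intro j
    simp only [hF]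
    rw [MeasureTheory.integral_const_mul, ← MeasureTheory.integral_Ioc_eq_integral_Ioo,
      ← intervalIntegral.integral_of_le zero_le_one, hmellin,
      gammaRatio_add_natCast n1 n2 n3 n4 n5 n6, ← hR, hT,
      genHypergeometricTerm_eq α α' β β' γ ρ z hlower]
    have hzp : (4 * z) ^ j = (-1) ^ j * (c * x) ^ (2 * j) := by
      rw [hz, pow_mul, ← mul_pow]
      ring
    rw [hzp]
    ring
  have hFcos : ∀ s ∈ Set.Ioo (0 : ℝ) 1, ∑' j, F j s =
      mellinIntegrand ρ γ h s * Complex.cos (c * ((x * s : ℝ) : ℂ)) := by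
    intro s hs
    rw [← (Complex.hasSum_cos (c * ((x * s : ℝ) : ℂ))).tsum_eq, ← tsum_mul_left]
    refine tsum_congr fun j => ?_
    simp only [hF]
    rw [mellinIntegrand_add_natCast hs.1]
    push_cast
    rw [show c * (x * (s : ℂ)) = c * x * s by ring, mul_pow (c * (x : ℂ))]
    ring
  rw [MeasureTheory.setIntegral_congr_fun measurableSet_Ioo hFcos] at hFsum
  simp only [hterm] at hFsum
  have hTsum : Summable T :=
    (summable_mul_left_iff (mul_ne_zero hG0 hR0)).1 hFsum.summable
  have hunit : ∫ s in (0 : ℝ)..1, mellinIntegrand ρ γ h s * Complex.cos (c * ((x * s : ℝ) : ℂ)) =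
      Complex.Gamma γ * R * ∑' j, T j := by
    rw [intervalIntegral.integral_of_le zero_le_one, MeasureTheory.integral_Ioc_eq_integral_Ioo,
      ← hFsum.tsum_eq, tsum_mul_left]
  have hunitInt : IntervalIntegrable
      (fun s : ℝ => mellinIntegrand ρ γ h s * Complex.cos (c * ((x * s : ℝ) : ℂ)))
      MeasureTheory.volume 0 1 :=
    (intervalIntegrable_mellinIntegrand hd hgrow hσρ hγ).mul_continuousOn (by fun_prop)
  -- rescaling to `(0, x)`
  have heq : ∀ t ∈ Set.Ioo (0 : ℝ) x,
      msmIntegrand α α' β β' γ (fun t : ℝ => (t : ℂ) ^ (ρ - 1) * Complex.cos (c * t)) x t =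
      (x : ℂ) ^ (ρ - α' + γ - 2) * (mellinIntegrand ρ γ h (t / x) *
        Complex.cos (c * ((x * (t / x) : ℝ) : ℂ))) := by
    intro t ht
    rw [msmIntegrand_eq α α' β β' ρ hγ (fun t : ℝ => Complex.cos (c * t)) ht.1 ht.2, ← hδ, ← hh,
      mul_div_cancel₀ _ hx.ne']
  refine ⟨?_, hTsum, ?_⟩
  · have h1 := (hunitInt.comp_mul_left (c := x⁻¹)).const_mul ((x : ℂ) ^ (ρ - α' + γ - 2))
    rw [zero_div, one_div, inv_inv] at h1
    rw [intervalIntegrable_iff_integrableOn_Ioo_of_le hx.le] at h1 ⊢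
    refine h1.congr_fun (fun t ht => ?_) measurableSet_Ioo
    rw [heq t ht]
    simp only [div_eq_inv_mul]
  · have h1 : ∫ t in (0 : ℝ)..x, msmIntegrand α α' β β' γ
        (fun t : ℝ => (t : ℂ) ^ (ρ - 1) * Complex.cos (c * t)) x t =
        (x : ℂ) ^ (ρ - α' + γ - 2) * ∫ t in (0 : ℝ)..x, (fun s : ℝ => mellinIntegrand ρ γ h s *
          Complex.cos (c * ((x * s : ℝ) : ℂ))) (t / x) := by
      rw [intervalIntegral.integral_of_le hx.le, intervalIntegral.integral_of_le hx.le,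
        MeasureTheory.integral_Ioc_eq_integral_Ioo, MeasureTheory.integral_Ioc_eq_integral_Ioo,
        ← MeasureTheory.integral_const_mul]
      exact MeasureTheory.setIntegral_congr_fun measurableSet_Ioo heq
    have h2 := intervalIntegral.integral_comp_div (a := 0) (b := x) (fun s : ℝ =>
      mellinIntegrand ρ γ h s * Complex.cos (c * ((x * s : ℝ) : ℂ))) hx.ne'
    rw [h2, zero_div, div_self hx.ne', hunit] at h1
    rw [msmIntegral, h1, Complex.real_smul, genHypergeometric, ← hT]
    have e : (x : ℂ) ^ (ρ - α - α' + γ - 1) =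
        (x : ℂ) ^ (-α) * ((x : ℂ) ^ (ρ - α' + γ - 2) * x) := by
      nth_rewrite 4 [← Complex.cpow_one (x : ℂ)]
      rw [← Complex.cpow_add _ _ hx0, ← Complex.cpow_add _ _ hx0]
      ring_nf
    rw [e]
    field_simp

theorem mainTheorem7 (α α' β β' γ ρ c : ℂ) (x : ℝ) (hx : 0 < x) (hγ : 0 < γ.re)
    (hρ : max 0 (max (α + α' + β - γ).re (α' - β').re) < ρ.re)
    (hlower : ∀ (j : Fin 7) (n : ℕ), lowerParams α α' β β' γ ρ j ≠ -(n : ℂ)) :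
    (IntervalIntegrable
        (msmIntegrand α α' β β' γ (fun t : ℝ => (t : ℂ) ^ (ρ - 1) * Complex.cos (c * t)) x)
        MeasureTheory.volume 0 x ∧
      Summable (genHypergeometricTerm (upperParams α α' β β' γ ρ) (lowerParams α α' β β' γ ρ)
        (-(c ^ 2 * (x : ℂ) ^ 2 / 4))) ∧
      msmIntegral α α' β β' γ (fun t : ℝ => (t : ℂ) ^ (ρ - 1) * Complex.cos (c * t)) x =
        gammaRatio ρ (ρ + γ - α - α' - β) (ρ + β' - α')
            (ρ + β') (ρ + γ - α - α') (ρ + γ - α' - β) *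
          (x : ℂ) ^ (ρ - α - α' + γ - 1) *
          genHypergeometric (upperParams α α' β β' γ ρ) (lowerParams α α' β β' γ ρ)
            (-(c ^ 2 * (x : ℂ) ^ 2 / 4))) ∧
    (IntervalIntegrable
        (msmIntegrand α α' β β' γ (fun t : ℝ => (t : ℂ) ^ (ρ - 1) * Complex.cosh (c * t)) x)
        MeasureTheory.volume 0 x ∧
      Summable (genHypergeometricTerm (upperParams α α' β β' γ ρ) (lowerParams α α' β β' γ ρ)
        (c ^ 2 * (x : ℂ) ^ 2 / 4)) ∧
      msmIntegral α α' β β' γ (fun t : ℝ => (t : ℂ) ^ (ρ - 1) * Complex.cosh (c * t)) x =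
        gammaRatio ρ (ρ + γ - α - α' - β) (ρ + β' - α')
            (ρ + β') (ρ + γ - α - α') (ρ + γ - α' - β) *
          (x : ℂ) ^ (ρ - α - α' + γ - 1) *
          genHypergeometric (upperParams α α' β β' γ ρ) (lowerParams α α' β β' γ ρ)
            (c ^ 2 * (x : ℂ) ^ 2 / 4)) := by
  refine ⟨msmIntegral_cos α α' β β' γ ρ c x hx hγ hρ hlower, ?_⟩
  have h := msmIntegral_cos α α' β β' γ ρ (c * Complex.I) x hx hγ hρ hlower
  have e : -((c * Complex.I) ^ 2 * (x : ℂ) ^ 2 / 4) = c ^ 2 * (x : ℂ) ^ 2 / 4 := by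
    rw [mul_pow, Complex.I_sq]
    ring
  have e2 : ∀ t : ℝ, Complex.cos (c * Complex.I * t) = Complex.cosh (c * t) := fun t => by
    rw [mul_right_comm, Complex.cos_mul_I]
  simpa only [e, e2] using h
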